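/- Let $R$ be a commutative ring and let $m,n\ge 1$ be integers, with $\mathfrak m=\max(m,n)$. The bi-directed cycle $C_{m,n}$ is the directed graph obtained from two directed intervals, of lengths $m$ and $n$, by identifying their initial vertices and identifying their final vertices (without parallel edges, so $C_{1,1}$ is a single edge). For a directed graph $G$ with shortest path metric $d$, let $\mathrm{RC}_k(G)$ be the free $R$-module on the tuples $(x_0,\dots,x_k)$ of vertices in which consecutive entries are distinct and each entry is joined to the next by a directed path, with differential $\partial(x_0,\dots,x_k)=\sum_{i=0}^k(-1)^i(x_0,\dots,\widehat{x_i},\dots,x_k)$, where terms with repeated consecutive entries are omitted. Let $F_\ell\mathrm{RC}_*(G)$ be the subcomplex spanned by the tuples with $\sum_i d(x_{i-1},x_i)\le \ell$. The magnitude-path spectral sequence (MPSS) $\{E^r_{i,j}(G),d^r\}_{r\ge 0}$ is the spectral sequence of this filtered complex, where $i$ is the filtration degree, $i+j$ is the homological degree, and $d^r\colon E^r_{i,j}\to E^r_{i-r,j+r-1}$. The bigraded path homology of $G$ is $\mathrm{PH}_{k,\ell}(G)=E^2_{\ell,k-\ell}(G)$. Below, bidegrees are always the bidegrees $(i,j)$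 of the spectral sequence, so that $\mathrm{PH}_{i+j,i}(G)=E^2_{i,j}(G)$ lies in bidegree $(i,j)$. **Theorem (bigraded path homology and MPSS of bi-directed cycles).** 1. If $\mathfrak m\ge 3$, then the bigraded path homology $\mathrm{PH}_{*,*}(C_{m,n})$ is concentrated in the bidegrees $(0,0)$, $(1,0)$ and $(\mathfrak m,-(\mathfrak m-2))$, in each of which it is free of rank $1$ over $R$. Moreover $$E^2(C_{m,n})=\cdots=E^{\mathfrak m-1}(C_{m,n}),$$ that is, $d^r=0$ for $2\le r\le \mathfrak m-2$ and these pages are identified by sending the class of an element to the class of the same element; and $E^{\mathfrak m}(C_{m,n})$ is trivial, consisting of a single copy of $R$ in bidegree $(0,0)$. 2. If $\mathfrak m\in\{1,2\}$, then the bigraded path homology of $C_{m,n}$ is concentrated in bidegree $(0,0)$, where it is free of rank $1$ over $R$. -/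

import Mathlib

namespace MPSS

universe u v

/-! ### Directed graphs and the shortest path metric

Directed graphs are terms of `Digraph V`: loops are allowed, parallel edges are not. -/

section Graph

variable {V : Type v}

/-- `HasPath G k x y`: there is a directed path with `k` edges from `x` to `y` in `G`. -/
inductive HasPath (G : Digraph V) : ℕ → V → V → Prop
  | refl (x : V) : HasPath G 0 x x
  | cons {k : ℕ} {x y z : V} : G.Adj x y → HasPath G k y z → HasPath G (k + 1) x z

/-- There is a directed path from `x` to `y`. -/
def Reach (G : Digraph V) (x y : V) : Prop := ∃ k, HasPath G k x y

/-- The shortest path metric: the least number of edges of a directed path from `x` to `y`,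
and `⊤` if there is no such path. -/
noncomputable def dist (G : Digraph V) (x y : V) : ℕ∞ :=
  ⨅ (k : ℕ) (_ : HasPath G k x y), (k : ℕ∞)

theorem HasPath.append {G : Digraph V} {k l : ℕ} {x y z : V} (h : HasPath G k x y)
    (h' : HasPath G l y z) : HasPath G (k + l) x z := by
  induction h with
  | refl => simpa using h'
  | cons e _ ih => simpa [Nat.add_right_comm] using HasPath.cons e (ih h')

theorem Reach.trans {G : Digraph V} {x y z : V} (h : Reach G x y) (h' : Reach G y z) :
    Reach G x z := by
  obtain ⟨k, hk⟩ := h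
  obtain ⟨l, hl⟩ := h'
  exact ⟨k + l, hk.append hl⟩

theorem dist_triangle (G : Digraph V) (x y z : V) : dist G x z ≤ dist G x y + dist G y z := by
  unfold dist
  refine ENat.le_iInf₂_add_iInf₂ fun k hk l hl => ?_
  exact_mod_cast iInf₂_le (f := fun (k : ℕ) (_ : HasPath G k x z) => (k : ℕ∞)) (k + l)
    (hk.append hl)

theorem dist_ne_top {G : Digraph V} {x y : V} (h : Reach G x y) : dist G x y ≠ ⊤ := by
  obtain ⟨k, hk⟩ := h
  have : dist G x y ≤ (k : ℕ∞) := iInf₂_le (f := fun (k : ℕ) (_ : HasPath G k x y) => (k : ℕ∞)) k hk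
  exact ne_top_of_le_ne_top (ENat.natCast_ne_top k) this

/-- `ℓ(x₀, …, x_k) = d(x₀, x₁) + ⋯ + d(x_{k-1}, x_k)`, tuples being given as lists. -/
noncomputable def tupleLength (G : Digraph V) : List V → ℕ∞
  | [] => 0
  | [_] => 0
  | x :: y :: l => dist G x y + tupleLength G (y :: l)

theorem tupleLength_tail_le (G : Digraph V) (x : V) (l : List V) :
    tupleLength G l ≤ tupleLength G (x :: l) := by
  cases l with
  | nil => simp [tupleLength]
  | cons y l => simp [tupleLength]

theorem tupleLength_eraseIdx_le (G : Digraph V) (l : List V) (i : ℕ) :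
    tupleLength G (l.eraseIdx i) ≤ tupleLength G l := by
  induction l generalizing i with
  | nil => simp
  | cons x l ih =>
    cases i with
    | zero => simpa using tupleLength_tail_le G x l
    | succ i =>
      cases l with
      | nil => simp
      | cons y l =>
        cases i with
        | zero =>
          cases l with
          | nil => simp [tupleLength]
          | cons z l =>
            simp only [List.eraseIdx_cons_succ, List.eraseIdx_cons_zero, tupleLength]
            rw [← add_assoc]
            gcongr
            exact dist_triangle G x y z
        | succ i =>
          have := ih (i + 1)
          simp only [List.eraseIdx_cons_succ, tupleLength] at this ⊢
          gcongr

/-- The condition on a nonempty tuple `(x₀, …, x_k)` to be a generator of the reachability chains: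
consecutive entries are distinct, and there is a directed path from each entry to the next. -/
def IsGenerator (G : Digraph V) (l : List V) : Prop :=
  l ≠ [] ∧ l.IsChain (fun x y => x ≠ y ∧ Reach G x y)

/-- The generators `(x₀, …, x_k)` of the reachability chain complex, in all degrees `k ≥ 0`. -/
@[ext]
structure Tuple (G : Digraph V) : Type v where
  /-- the list `[x₀, …, x_k]` -/
  toList : List V
  isGenerator : IsGenerator G toList

/-- The degree of `(x₀, …, x_k)` is `k`. -/
def Tuple.deg {G : Digraph V} (c : Tuple G) : ℤ := (c.toList.length : ℤ) - 1

/-- The length of a generator; it is finite, see `Tuple.coe_length`. -/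
noncomputable def Tuple.length {G : Digraph V} (c : Tuple G) : ℕ := (tupleLength G c.toList).toNat

theorem tupleLength_ne_top {G : Digraph V} {l : List V}
    (h : l.IsChain (fun x y => x ≠ y ∧ Reach G x y)) : tupleLength G l ≠ ⊤ := by
  induction l with
  | nil => simp [tupleLength]
  | cons x l ih =>
    cases l with
    | nil => simp [tupleLength]
    | cons y l =>
      rw [List.isChain_cons_cons] at h
      simp only [tupleLength, ne_eq, ENat.add_eq_top, not_or]
      exact ⟨dist_ne_top h.1.2, ih h.2⟩

theorem Tuple.coe_length {G : Digraph V} (c : Tuple G) :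
    (c.length : ℕ∞) = tupleLength G c.toList :=
  ENat.natCast_toNat (tupleLength_ne_top c.isGenerator.2)

end Graph

/-! ### The reachability chain complex -/

section Chains

variable (R : Type u) [CommRing R] {V : Type v} (G : Digraph V)

/-- The free `R`-module on all generators `(x₀, …, x_k)`, `k ≥ 0`, that is, the direct sum of all
the modules of reachability chains. -/
abbrev RC : Type (max u v) := Tuple G →₀ R

open Classical in
/-- The tuple `l` as a reachability chain; it is `0` if `l` is empty or has repeated
consecutive entries. -/
noncomputable def chainOf (l : List V) : RC R G :=
  if h : IsGenerator G l then Finsupp.single (⟨l, h⟩ : Tuple G) 1 else 0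

/-- The differential `∂(x₀, …, x_k) = ∑ᵢ (-1)ⁱ (x₀, …, x̂ᵢ, …, x_k)`, where terms with repeated
consecutive entries are omitted (and `∂(x₀) = 0`). -/
noncomputable def boundary : RC R G →ₗ[R] RC R G :=
  Finsupp.linearCombination R fun c : Tuple G =>
    ∑ i ∈ Finset.range c.toList.length, (-1 : R) ^ i • chainOf R G (c.toList.eraseIdx i)

/-- The chains of degree `n`. -/
noncomputable def RCdeg (n : ℤ) : Submodule R (RC R G) :=
  Finsupp.supported R R {c | c.deg = n}

/-- The chains of degree `n` spanned by the generators of length at most `p`. -/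
noncomputable def RCfil (p n : ℤ) : Submodule R (RC R G) :=
  Finsupp.supported R R {c | c.deg = n ∧ (c.length : ℤ) ≤ p}

theorem boundary_single (c : Tuple G) : boundary R G (Finsupp.single c 1) =
    ∑ i ∈ Finset.range c.toList.length, (-1 : R) ^ i • chainOf R G (c.toList.eraseIdx i) := by
  simp [boundary]

theorem isInternal_RCdeg : DirectSum.IsInternal (RCdeg R G) := by
  rw [DirectSum.isInternal_submodule_iff_iSupIndep_and_iSup_eq_top]
  constructor
  · intro n
    have : (⨆ (j : ℤ) (_ : j ≠ n), RCdeg R G j) ≤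
        Finsupp.supported R R {c : Tuple G | c.deg ≠ n} := by
      refine iSup₂_le fun j hj => Finsupp.supported_mono fun c hc => ?_
      exact fun h => hj (hc.symm.trans h)
    refine Disjoint.mono_right this (Finsupp.disjoint_supported_supported ?_)
    rw [Set.disjoint_left]
    intro c hc hc'
    exact hc' hc
  · unfold RCdeg
    rw [← Finsupp.supported_iUnion, eq_top_iff]
    have : (⋃ i : ℤ, {c : Tuple G | c.deg = i}) = Set.univ := by
      ext c; simp
    rw [this, Finsupp.supported_univ]

theorem boundary_mem {p n : ℤ} {x : RC R G} (hx : x ∈ RCfil R G p n) :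
    boundary R G x ∈ RCfil R G p (n - 1) := by
  unfold boundary
  rw [Finsupp.linearCombination_apply]
  refine Submodule.sum_mem _ fun c hc => Submodule.smul_mem _ _ <|
    Submodule.sum_mem _ fun i hi => Submodule.smul_mem _ _ ?_
  obtain ⟨hd, hl⟩ := (Finsupp.mem_supported R x).1 hx hc
  unfold chainOf
  split_ifs with h
  · refine Finsupp.single_mem_supported R 1 ⟨?_, ?_⟩
    · have h1 := List.length_eraseIdx_of_lt (Finset.mem_range.1 hi)
      have h2 := Finset.mem_range.1 hi
      simp only [Tuple.deg] at hd ⊢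
      rw [h1]
      omega
    · refine le_trans ?_ hl
      have h1 := tupleLength_eraseIdx_le G c.toList i
      have h2 := Tuple.coe_length (⟨c.toList.eraseIdx i, h⟩ : Tuple G)
      rw [← Tuple.coe_length] at h1
      rw [← h2] at h1
      exact_mod_cast h1
  · exact Submodule.zero_mem _

end Chains

/-! ### The differential squares to zero -/

section Square

variable (R : Type u) [CommRing R] {V : Type v} (G : Digraph V)

/-- Prepending a vertex to all tuples. -/
noncomputable def consL (a : V) : (List V →₀ R) →ₗ[R] (List V →₀ R) :=
  Finsupp.lmapDomain R R (List.cons a)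

/-- The alternating sum of faces on all tuples. -/
noncomputable def faces (l : List V) : List V →₀ R :=
  ∑ i ∈ Finset.range l.length, (-1 : R) ^ i • Finsupp.single (l.eraseIdx i) 1

theorem faces_cons (a : V) (l : List V) :
    faces R (a :: l) = Finsupp.single l 1 - consL R a (faces R l) := by
  unfold faces
  rw [List.length_cons, Finset.sum_range_succ']
  simp only [List.eraseIdx_cons_succ, List.eraseIdx_cons_zero, pow_zero, one_smul, map_sum,
    map_smul, consL, Finsupp.lmapDomain_apply, Finsupp.mapDomain_single, pow_succ, mul_neg_one,
    neg_smul, Finset.sum_neg_distrib]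
  abel

/-- The linear extension of `faces`. -/
noncomputable def facesL : (List V →₀ R) →ₗ[R] (List V →₀ R) :=
  Finsupp.linearCombination R (faces R)

theorem facesL_consL (a : V) (y : List V →₀ R) :
    facesL R (consL R a y) = y - consL R a (facesL R y) := by
  have : facesL R ∘ₗ consL R a = LinearMap.id - consL R a ∘ₗ facesL R := by
    refine Finsupp.lhom_ext' fun l => LinearMap.ext_ring ?_
    simp [facesL, consL, faces_cons]
  exact LinearMap.congr_fun this y

theorem facesL_faces (l : List V) : facesL R (faces R l) = 0 := by
  induction l with
  | nil => simp [faces]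
  | cons a l ih =>
    rw [faces_cons, map_sub, facesL_consL, ih]
    simp [facesL]

/-- The span of the tuples with repeated consecutive entries. -/
noncomputable def degen : Submodule R (List V →₀ R) :=
  Finsupp.supported R R {l | ∃ (u : List V) (a : V) (w : List V), l = u ++ a :: a :: w}

theorem consL_mem_degen (b : V) {y : List V →₀ R} (hy : y ∈ degen R (V := V)) :
    consL R b y ∈ degen R (V := V) := by
  classical
  unfold degen at hy ⊢
  rw [Finsupp.mem_supported] at hy ⊢
  refine (Finset.coe_subset.2 Finsupp.mapDomain_support).trans ?_
  intro l hl
  simp only [Finset.coe_image, Set.mem_image] at hl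
  obtain ⟨l', hl', rfl⟩ := hl
  obtain ⟨u, a, w, rfl⟩ := hy hl'
  exact ⟨b :: u, a, w, rfl⟩

theorem consL_consL_mem_degen (a : V) (y : List V →₀ R) :
    consL R a (consL R a y) ∈ degen R (V := V) := by
  induction y using Finsupp.induction_linear with
  | zero => simp
  | add f g hf hg => simpa using Submodule.add_mem _ hf hg
  | single l r =>
    simp only [consL, Finsupp.lmapDomain_apply, Finsupp.mapDomain_single]
    exact Finsupp.single_mem_supported R r ⟨[], a, l, rfl⟩

theorem faces_mem_degen (u : List V) (a : V) (w : List V) :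
    faces R (u ++ a :: a :: w) ∈ degen R (V := V) := by
  induction u with
  | nil =>
    have : faces R ([] ++ a :: a :: w) = consL R a (consL R a (faces R w)) := by
      have h : consL R a (Finsupp.single w 1) = Finsupp.single (a :: w) 1 := by
        simp [consL]
      rw [List.nil_append, faces_cons, faces_cons, map_sub, h]
      abel
    rw [this]
    exact consL_consL_mem_degen R a _
  | cons b u ih =>
    rw [List.cons_append, faces_cons]
    exact Submodule.sub_mem _ (Finsupp.single_mem_supported R 1 ⟨u, a, w, rfl⟩)
      (consL_mem_degen R b ih)

/-- The linear extension of `chainOf`. -/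
noncomputable def chainL : (List V →₀ R) →ₗ[R] RC R G :=
  Finsupp.linearCombination R (chainOf R G)

theorem chainL_degen {y : List V →₀ R} (hy : y ∈ degen R (V := V)) : chainL R G y = 0 := by
  unfold chainL
  rw [Finsupp.linearCombination_apply]
  refine Finset.sum_eq_zero fun l hl => ?_
  obtain ⟨u, a, w, rfl⟩ := (Finsupp.mem_supported R y).1 hy hl
  have : ¬ IsGenerator G (u ++ a :: a :: w) := by
    rintro ⟨-, h⟩
    have := h.right_of_append
    rw [List.isChain_cons_cons] at this
    exact this.1.1 rfl
  simp [chainOf, this]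

theorem exists_repeat {l : List V} (h : l.IsChain (Reach G))
    (h' : ¬ l.IsChain (fun x y => x ≠ y ∧ Reach G x y)) :
    ∃ (u : List V) (a : V) (w : List V), l = u ++ a :: a :: w := by
  induction l with
  | nil => simp at h'
  | cons x l ih =>
    cases l with
    | nil => simp at h'
    | cons y l =>
      by_cases hxy : x = y
      · subst hxy
        exact ⟨[], x, l, rfl⟩
      · rw [List.isChain_cons_cons] at h h'
        obtain ⟨u, a, w, e⟩ := ih h.2 fun h3 => h' ⟨⟨hxy, h.1⟩, h3⟩
        exact ⟨x :: u, a, w, by rw [e]; rfl⟩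

theorem boundary_chainOf {l : List V} (h : l.IsChain (Reach G)) :
    boundary R G (chainOf R G l) = chainL R G (faces R l) := by
  by_cases hl : IsGenerator G l
  · rw [chainOf, dif_pos hl, boundary_single]
    simp [chainL, faces]
  · rcases eq_or_ne l [] with rfl | hne
    · simp [chainOf, hl, faces]
    · obtain ⟨u, a, w, rfl⟩ := exists_repeat G h fun h' => hl ⟨hne, h'⟩
      rw [chainL_degen R G (faces_mem_degen R u a w)]
      simp [chainOf, hl]

theorem boundary_boundary (x : RC R G) : boundary R G (boundary R G x) = 0 := by
  have : boundary R G ∘ₗ boundary R G = 0 := by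
    refine Finsupp.lhom_ext' fun c => LinearMap.ext_ring ?_
    have hc : c.toList.IsChain (Reach G) := c.isGenerator.2.imp fun _ _ h => h.2
    have : IsTrans V (Reach G) := ⟨fun _ _ _ => Reach.trans⟩
    have h1 : ∀ i, (c.toList.eraseIdx i).IsChain (Reach G) := fun i =>
      hc.sublist (List.eraseIdx_sublist _ _)
    simp only [LinearMap.coe_comp, Function.comp_apply, Finsupp.lsingle_apply,
      LinearMap.zero_apply]
    rw [boundary_single, map_sum]
    simp only [map_smul, boundary_chainOf R G (h1 _)]
    simp only [← map_smul, ← map_sum]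
    have h3 : ∑ i ∈ Finset.range c.toList.length, (-1 : R) ^ i • faces R (c.toList.eraseIdx i) =
        facesL R (faces R c.toList) := by
      simp [facesL, faces]
    rw [h3, facesL_faces, map_zero]
  exact LinearMap.congr_fun this x

end Square

/-! ### Filtered complexes and their spectral sequences -/

/-- A filtered chain complex of `R`-modules, written inside the direct sum `M` of its terms. -/
structure FilteredComplex (R : Type u) [CommRing R] (M : Type v) [AddCommGroup M] [Module R M] where
  /-- the terms of the complex -/
  C : ℤ → Submodule R M
  isInternal : DirectSum.IsInternal C
  /-- the differential -/
  d : M →ₗ[R] M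
  d_mem_C : ∀ {n : ℤ} {x : M}, x ∈ C n → d x ∈ C (n - 1)
  d_d : ∀ x, d (d x) = 0
  /-- `F p n` is stage `p` of the filtration of the term `C n` -/
  F : ℤ → ℤ → Submodule R M
  F_le : ∀ p n, F p n ≤ C n
  F_mono : ∀ {p q : ℤ}, p ≤ q → ∀ n, F p n ≤ F q n
  d_mem_F : ∀ {p n : ℤ} {x : M}, x ∈ F p n → d x ∈ F p (n - 1)

namespace FilteredComplex

variable {R : Type u} [CommRing R] {M : Type v} [AddCommGroup M] [Module R M]
  (K : FilteredComplex R M)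

/-- `A^r_p = {x ∈ F_p C_n | d x ∈ F_{p-r} C_{n-1}}`, the elements of filtration `p` that are cycles
modulo filtration `p - r`. -/
def A (r p n : ℤ) : Submodule R M := K.F p n ⊓ (K.F (p - r) (n - 1)).comap K.d

/-- The submodule `A^{r-1}_{p-1} + d (A^{r-1}_{p+r-1})`. -/
def B (r p n : ℤ) : Submodule R M :=
  K.A (r - 1) (p - 1) n ⊔ (K.A (r - 1) (p + r - 1) (n + 1)).map K.d

/-- Page `r` of the spectral sequence in filtration degree `p` and total degree `n`,
`E^r_{p, n-p} = A^r_p / (A^{r-1}_{p-1} + d (A^{r-1}_{p+r-1}))`. -/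
abbrev page (r : ℕ) (p n : ℤ) : Type v := K.A r p n ⧸ (K.B r p n).submoduleOf (K.A r p n)

/-- The class in `E^r` of an element of `A^r_p`. -/
def cls (r : ℕ) (p n : ℤ) : K.A r p n →ₗ[R] K.page r p n :=
  ((K.B r p n).submoduleOf (K.A r p n)).mkQ

theorem B_le_A (r p n : ℤ) : K.B r p n ≤ K.A r p n := by
  refine sup_le ?_ ?_
  · rintro x ⟨h1, h2⟩
    refine ⟨K.F_mono (by omega) n h1, ?_⟩
    rw [show p - 1 - (r - 1) = p - r by ring] at h2
    exact h2
  · rintro _ ⟨x, ⟨-, h2⟩, rfl⟩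
    rw [show p + r - 1 - (r - 1) = p by ring, show n + 1 - 1 = n by ring] at h2
    refine ⟨h2, ?_⟩
    simp [K.d_d]

theorem A_anti {r s : ℤ} (h : r ≤ s) (p n : ℤ) : K.A s p n ≤ K.A r p n := by
  rintro x ⟨h1, h2⟩
  exact ⟨h1, K.F_mono (by omega) _ h2⟩

theorem d_mem_A {r p n : ℤ} {x : M} (hx : x ∈ K.A r p n) : K.d x ∈ K.A r (p - r) (n - 1) :=
  ⟨hx.2, by simp [K.d_d]⟩

theorem d_mem_B {r p n : ℤ} {x : M} (hx : x ∈ K.B r p n) : K.d x ∈ K.B r (p - r) (n - 1) := by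
  obtain ⟨y, hy, _, ⟨z, -, rfl⟩, rfl⟩ := Submodule.mem_sup.1 hx
  rw [map_add, K.d_d, add_zero]
  refine Submodule.mem_sup_right ⟨y, ?_, rfl⟩
  rw [show p - r + r - 1 = p - 1 by ring, show n - 1 + 1 = n by ring]
  exact hy

/-- The differential `d^r : E^r_{p, n-p} → E^r_{p-r, n-p+r-1}`, `[x] ↦ [d x]`. -/
def diff (r : ℕ) (p n : ℤ) : K.page r p n →ₗ[R] K.page r (p - r) (n - 1) :=
  Submodule.mapQ _ _ (K.d.restrict fun _ hx => K.d_mem_A hx) fun _ hx => K.d_mem_B hx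

end FilteredComplex

/-! ### The magnitude-path spectral sequence -/

section Spectral

variable (R : Type u) [CommRing R] {V : Type v} (G : Digraph V)

/-- The reachability chain complex with its length filtration. -/
noncomputable def filteredRC : FilteredComplex R (RC R G) where
  C := RCdeg R G
  isInternal := isInternal_RCdeg R G
  d := boundary R G
  d_mem_C := by
    intro n x hx
    obtain ⟨p, hp⟩ : ∃ p : ℤ, x ∈ RCfil R G p n := by
      refine ⟨((x.support.sup Tuple.length : ℕ) : ℤ), (Finsupp.mem_supported R x).2 ?_⟩
      intro c hc
      exact ⟨(Finsupp.mem_supported R x).1 hx hc,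
        by exact_mod_cast Finset.le_sup (f := Tuple.length) (Finset.mem_coe.1 hc)⟩
    exact Finsupp.supported_mono (fun c hc => hc.1) (boundary_mem R G hp)
  d_d := boundary_boundary R G
  F := RCfil R G
  F_le _ _ := Finsupp.supported_mono fun _ hc => hc.1
  F_mono h _ := Finsupp.supported_mono fun _ hc => ⟨hc.1, hc.2.trans h⟩
  d_mem_F := boundary_mem R G

/-- The term `E^r_{i,j}(G)` of the magnitude-path spectral sequence of `G`. -/
abbrev E (r : ℕ) (i j : ℤ) : Type (max u v) := (filteredRC R G).page r i (i + j)

/-- Bigraded path homology, `PH_{k,ℓ}(G) = E^2_{ℓ,k-ℓ}(G)`. -/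
abbrev PH (k l : ℤ) : Type (max u v) := E R G 2 l (k - l)

end Spectral

/-- The bi-directed cycle `C_{m,n}` for `m, n ≥ 1`: the cycle on the vertices `0, …, m + n - 1`,
with the `m` edges `0 → 1 → ⋯ → m` oriented in one direction and the remaining `n` edges
`0 → m + n - 1 → ⋯ → m + 1 → m` oriented in the other. -/
def biCycle (m n : ℕ) : Digraph (Fin (m + n)) where
  Adj x y := (x.val < m ∧ y.val = x.val + 1) ∨ (m ≤ y.val ∧ x.val = (y.val + 1) % (m + n))

end MPSS

namespace MPSS

universe u v

/-! ### Prepending edges to tuples -/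

section Edges

variable (R : Type u) [CommRing R] {V : Type v}

/-! From the second page on, the spectral sequence is unchanged by any chain homotopy that raises
the length filtration by at most one (`FilteredComplex.sub_mem_B`). So it suffices to contract the
reachability chains onto a tiny subcomplex by such a homotopy.

For each reachable pair choose a combination `E x y` of edges on a geodesic, with boundary `y - x`.
The homotopy replaces the first vertex of `(x, y, …)` by the edges of `E x y`, with a minus sign; a
single vertex `(x)` is treated as if it were followed by the final vertex `w`. By a Leibniz rule for
prepended edges (`facesL_attach`), the identity is homotopic to a map that sees only the defects `E
x y + E y z - E x z` (`facesL_pathHomotopy`). Following geodesics keeps the length bounded; only on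
single vertices can it grow, by at most one (`chainHomotopy_mem`).

In a union of two intervals with common ends, let `I` be the interior of the longer one, of length
`a`, and let `γ` be the longer interval minus the other one. The defect is `γ` when `x ∉ I`, `y ∈
I`, `z = w`, and zero otherwise (`pathDefect_eq`). What remains is spanned by `(w)` in filtration 0
and degree 0, the loop on `γ` in filtration 1 and degree 1, and the cone on the loop with apex `w`
in filtration `a` and degree 2. The boundary of the cone is the loop, so when `2 ≤ r < a` both
survive to page `r`, and the differential of page `a - 1`, which goes from filtration `a` to
filtration 1, cancels them.

Three coefficient sums, `vertexWeight`, `edgeWeight` and `triangleWeight`, detect these classes.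
They have the expected behaviour under the boundary (`weightedSum_boundary`), and they identify the
surviving terms with `R` in the same way on all pages, which gives the identification through common
representatives. -/

/-- Prepending a linear combination of pairs of vertices to tuples. -/
noncomputable def attach : (V × V →₀ R) →ₗ[R] (List V →₀ R) →ₗ[R] (List V →₀ R) :=
  Finsupp.linearCombination R fun e : V × V => consL R e.1 ∘ₗ consL R e.2

/-- Prepending a linear combination of vertices to tuples. -/
noncomputable def attachVertex : (V →₀ R) →ₗ[R] (List V →₀ R) →ₗ[R] (List V →₀ R) :=
  Finsupp.linearCombination R (consL R)

/-- The boundary of a pair of vertices is its end minus its start. -/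
noncomputable def edgeBoundary : (V × V →₀ R) →ₗ[R] (V →₀ R) :=
  Finsupp.linearCombination R fun e : V × V => Finsupp.single e.2 1 - Finsupp.single e.1 1

@[simp]
theorem consL_single (a : V) (l : List V) (r : R) :
    consL R a (Finsupp.single l r) = Finsupp.single (a :: l) r := by
  simp [consL]

@[simp]
theorem facesL_single (l : List V) : facesL R (Finsupp.single l 1) = faces R l := by
  simp [facesL]

@[simp]
theorem attach_single (e : V × V) (f : List V →₀ R) :
    attach R (Finsupp.single e 1) f = consL R e.1 (consL R e.2 f) := by
  simp [attach]

@[simp]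
theorem attachVertex_single (x : V) (f : List V →₀ R) :
    attachVertex R (Finsupp.single x 1) f = consL R x f := by
  simp [attachVertex]

@[simp]
theorem edgeBoundary_single (e : V × V) :
    edgeBoundary R (Finsupp.single e 1) = Finsupp.single e.2 1 - Finsupp.single e.1 1 := by
  simp [edgeBoundary]

/-- A Leibniz rule. The last term has a plus sign because the faces of `f` are taken after two
prepended vertices. -/
theorem facesL_attach (e : V × V →₀ R) (f : List V →₀ R) :
    facesL R (attach R e f) =
      attachVertex R (edgeBoundary R e) f + attach R e (facesL R f) := by
  induction e using Finsupp.induction_linear with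
  | zero => simp
  | add e e' he he' => simp only [map_add, LinearMap.add_apply, he, he']; abel
  | single p r =>
    rw [← mul_one r, ← smul_eq_mul, ← Finsupp.smul_single]
    simp only [map_smul, LinearMap.smul_apply, attach_single, facesL_consL, edgeBoundary_single,
      map_sub, LinearMap.sub_apply, attachVertex_single, ← smul_add]
    congr 1
    abel

theorem attach_mem_supported {s : Set (V × V)} {t : Set (List V)} {e : V × V →₀ R} {l : List V}
    (he : e ∈ Finsupp.supported R R s) (h : ∀ p ∈ s, p.1 :: p.2 :: l ∈ t) :
    attach R e (Finsupp.single l 1) ∈ Finsupp.supported R R t := by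
  unfold attach
  rw [Finsupp.linearCombination_apply, Finsupp.sum, LinearMap.sum_apply]
  refine Submodule.sum_mem _ fun p hp => ?_
  simp only [LinearMap.smul_apply, LinearMap.comp_apply, consL_single]
  exact Submodule.smul_mem _ _ (Finsupp.single_mem_supported R 1 (h p (he hp)))

end Edges

/-! ### The homotopy that follows chosen paths -/

section ListHomotopy

variable (R : Type u) [CommRing R] {V : Type v} (w : V) (E : V → V → (V × V →₀ R))

/-- The tuple `(x₀, x₁, …)` is sent to minus the sum of the tuples `(u, v, x₁, …)` over the edges
`(u, v)` of the chosen path from `x₀` to `x₁`, or to `w` if there is no `x₁`. -/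
noncomputable def pathHomotopy : List V → (List V →₀ R)
  | [] => 0
  | x :: l => -attach R (E x (l.headD w)) (Finsupp.single l 1)

/-- The linear extension of `pathHomotopy`. -/
noncomputable def pathHomotopyL : (List V →₀ R) →ₗ[R] (List V →₀ R) :=
  Finsupp.linearCombination R (pathHomotopy R w E)

/-- The difference between the concatenation of the chosen paths from `x` to `y` and from `y` to
`z` and the chosen path from `x` to `z`. -/
noncomputable def pathDefect (x y z : V) : V × V →₀ R := E x y + E y z - E x z

/-- The endomorphism of tuples to which the identity is homotopic. -/
noncomputable def pathProjection : List V → (List V →₀ R)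
  | [] => Finsupp.single [] 1
  | [_] => Finsupp.single [w] 1
  | x :: y :: l => Finsupp.single (y :: y :: l) 1 +
      attach R (pathDefect R E x y (l.headD w)) (Finsupp.single l 1)

@[simp]
theorem pathHomotopyL_single (l : List V) :
    pathHomotopyL R w E (Finsupp.single l 1) = pathHomotopy R w E l := by
  simp [pathHomotopyL]

theorem pathHomotopyL_consL_consL (x y : V) (f : List V →₀ R) :
    pathHomotopyL R w E (consL R x (consL R y f)) = -attach R (E x y) (consL R y f) := by
  have : pathHomotopyL R w E ∘ₗ consL R x ∘ₗ consL R y = -(attach R (E x y) ∘ₗ consL R y) := by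
    refine Finsupp.lhom_ext' fun l => LinearMap.ext_ring ?_
    simp [pathHomotopy]
  exact LinearMap.congr_fun this f

/-- The faces of the tail, with `E x y` prepended, occur on both sides with opposite signs. What is
left comes from deleting one of the first two vertices, and this produces the defect. The tuple `(y,
y, …)` in `pathProjection` is degenerate and vanishes as a reachability chain. -/
theorem facesL_pathHomotopy
    (hE : ∀ x y, edgeBoundary R (E x y) = Finsupp.single y 1 - Finsupp.single x 1) (l : List V) :
    facesL R (pathHomotopy R w E l) + pathHomotopyL R w E (faces R l) =
      Finsupp.single l 1 - pathProjection R w E l := by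
  match l with
  | [] => simp [pathHomotopy, pathProjection, faces]
  | [x] =>
    simp [pathHomotopy, pathProjection, facesL_attach, hE, faces]
  | x :: y :: l =>
    rw [faces_cons, faces_cons]
    simp only [map_sub, pathHomotopyL_single, pathHomotopyL_consL_consL, consL_single,
      pathProjection, pathDefect]
    simp only [pathHomotopy, List.headD_cons, map_neg, facesL_attach, hE, facesL_single, map_sub,
      map_add, LinearMap.sub_apply, LinearMap.add_apply, attachVertex_single, consL_single,
      faces_cons]
    abel

/-- This lets the homotopy descend to chains in which tuples with repetitions are zero. A repetition
in the first two places is killed by `E a a = 0`; any later one lies in the untouched tail. -/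
theorem pathHomotopy_mem_degen (hE : ∀ x, E x x = 0) (u : List V) (a : V) (s : List V) :
    pathHomotopy R w E (u ++ a :: a :: s) ∈ degen R (V := V) := by
  cases u with
  | nil => simp [pathHomotopy, hE]
  | cons b u =>
    refine Submodule.neg_mem _ (attach_mem_supported R (s := Set.univ) (by simp) ?_)
    rintro p -
    exact ⟨p.1 :: p.2 :: u, a, s, rfl⟩

end ListHomotopy

/-! ### The homotopy on reachability chains -/

section Reachability

variable (R : Type u) [CommRing R] {V : Type v} (G : Digraph V)

/-- The span of the tuples each of whose entries reaches the next. -/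
noncomputable def reachChains : Submodule R (List V →₀ R) :=
  Finsupp.supported R R {l | l.IsChain (Reach G)}

theorem Tuple.isChain_reach {G : Digraph V} (c : Tuple G) : c.toList.IsChain (Reach G) :=
  c.isGenerator.2.imp fun _ _ h => h.2

@[simp]
theorem chainL_single (l : List V) : chainL R G (Finsupp.single l 1) = chainOf R G l := by
  simp [chainL]

theorem chainOf_toList (c : Tuple G) : chainOf R G c.toList = Finsupp.single c 1 := by
  simp [chainOf, c.isGenerator]

theorem faces_mem_reachChains {l : List V} (h : l.IsChain (Reach G)) :
    faces R l ∈ reachChains R G := by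
  have : IsTrans V (Reach G) := ⟨fun _ _ _ => Reach.trans⟩
  exact Submodule.sum_mem _ fun i _ => Submodule.smul_mem _ _ <|
    Finsupp.single_mem_supported R 1 (h.sublist (List.eraseIdx_sublist _ _))

theorem eqOn_reachChains {N : Type*} [AddCommGroup N] [Module R N]
    {φ ψ : (List V →₀ R) →ₗ[R] N}
    (h : ∀ l : List V, l.IsChain (Reach G) → φ (Finsupp.single l 1) = ψ (Finsupp.single l 1))
    {f : List V →₀ R} (hf : f ∈ reachChains R G) : φ f = ψ f := by
  rw [← f.sum_single, Finsupp.sum, map_sum, map_sum]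
  refine Finset.sum_congr rfl fun l hl => ?_
  rw [← mul_one (f l), ← smul_eq_mul, ← Finsupp.smul_single, map_smul, map_smul, h l (hf hl)]

/-- Restricting to `reachChains` is essential: a list that `chainOf` kills for want of a path may
have faces that are generators. -/
theorem boundary_chainL {f : List V →₀ R} (hf : f ∈ reachChains R G) :
    boundary R G (chainL R G f) = chainL R G (facesL R f) :=
  eqOn_reachChains R G (φ := boundary R G ∘ₗ chainL R G) (ψ := chainL R G ∘ₗ facesL R)
    (fun l hl => by simp [boundary_chainOf R G hl]) hf

variable {G} in
/-- A choice of geodesics in a digraph, all of whose vertices reach `w`. The geodesic from `x` to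
`y` is given as the sum of its edges. -/
structure IsGeodesicChoice (w : V) (E : V → V → (V × V →₀ R)) : Prop where
  reach : ∀ x, Reach G x w
  boundary_eq : ∀ x y, edgeBoundary R (E x y) = Finsupp.single y 1 - Finsupp.single x 1
  self : ∀ x, E x x = 0
  mem : ∀ x y, Reach G x y → E x y ∈ Finsupp.supported R R
    {e | Reach G e.1 e.2 ∧ Reach G e.2 y ∧ dist G e.1 e.2 ≤ 1 ∧
      dist G e.1 e.2 + dist G e.2 y ≤ dist G x y}

/-- `pathHomotopy` on reachability chains. -/
noncomputable def chainHomotopy (w : V) (E : V → V → (V × V →₀ R)) : RC R G →ₗ[R] RC R G :=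
  Finsupp.linearCombination R fun c : Tuple G => chainL R G (pathHomotopy R w E c.toList)

variable {w : V} {E : V → V → (V × V →₀ R)}

theorem pathHomotopy_mem_reachChains (hE : IsGeodesicChoice R (G := G) w E) {l : List V}
    (hl : l.IsChain (Reach G)) : pathHomotopy R w E l ∈ reachChains R G := by
  match l with
  | [] => simp [pathHomotopy]
  | [x] =>
    refine Submodule.neg_mem _ (attach_mem_supported R (hE.mem x w (hE.reach x)) ?_)
    rintro p ⟨h, -⟩
    simpa using h
  | x :: y :: l =>
    rw [List.isChain_cons_cons] at hl
    refine Submodule.neg_mem _ (attach_mem_supported R (hE.mem x y hl.1) ?_)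
    rintro p ⟨h, h', -⟩
    simp [h, h', hl.2]

theorem chainHomotopy_chainL (hE : IsGeodesicChoice R (G := G) w E) {f : List V →₀ R}
    (hf : f ∈ reachChains R G) :
    chainHomotopy R G w E (chainL R G f) = chainL R G (pathHomotopyL R w E f) := by
  refine eqOn_reachChains R G (φ := chainHomotopy R G w E ∘ₗ chainL R G)
    (ψ := chainL R G ∘ₗ pathHomotopyL R w E) (fun l hl => ?_) hf
  simp only [LinearMap.comp_apply, chainL_single, pathHomotopyL_single]
  by_cases h : IsGenerator G l
  · simp [chainOf, h, chainHomotopy]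
  · rcases eq_or_ne l [] with rfl | hne
    · simp [chainOf, h, pathHomotopy]
    · obtain ⟨u, a, s, rfl⟩ := exists_repeat G hl fun h' => h ⟨hne, h'⟩
      rw [chainL_degen R G (pathHomotopy_mem_degen R w E hE.self u a s)]
      simp [chainOf, h]

theorem boundary_chainHomotopy_add (hE : IsGeodesicChoice R (G := G) w E) (c : Tuple G) :
    boundary R G (chainHomotopy R G w E (Finsupp.single c 1)) +
      chainHomotopy R G w E (boundary R G (Finsupp.single c 1)) =
    Finsupp.single c 1 - chainL R G (pathProjection R w E c.toList) := by
  have hc := c.isChain_reach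
  have h1 : chainHomotopy R G w E (Finsupp.single c 1) =
      chainL R G (pathHomotopy R w E c.toList) := by simp [chainHomotopy]
  rw [h1, boundary_chainL R G (pathHomotopy_mem_reachChains R G hE hc), ← chainOf_toList,
    boundary_chainOf R G hc, chainHomotopy_chainL R G hE (faces_mem_reachChains R G hc),
    ← map_add, facesL_pathHomotopy R w E hE.boundary_eq, map_sub, chainL_single]

theorem chainL_mem_RCfil {f : List V →₀ R} {p : ℕ} {n : ℤ}
    (hf : f ∈ Finsupp.supported R R {l : List V | (l.length : ℤ) - 1 = n ∧ tupleLength G l ≤ p}) :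
    chainL R G f ∈ RCfil R G p n := by
  unfold chainL
  rw [Finsupp.linearCombination_apply]
  refine Submodule.sum_mem _ fun l hl => Submodule.smul_mem _ _ ?_
  obtain ⟨h1, h2⟩ := hf hl
  unfold chainOf
  split_ifs with h
  · refine Finsupp.single_mem_supported R 1 ⟨h1, ?_⟩
    rw [← Tuple.coe_length ⟨l, h⟩] at h2
    exact_mod_cast h2
  · exact Submodule.zero_mem _

theorem map_mem_RCfil {φ : RC R G →ₗ[R] RC R G} {s t : ℤ}
    (h : ∀ c : Tuple G, φ (Finsupp.single c 1) ∈ RCfil R G (c.length + s) (c.deg + t))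
    {p n : ℤ} {x : RC R G} (hx : x ∈ RCfil R G p n) : φ x ∈ RCfil R G (p + s) (n + t) := by
  rw [← x.sum_single, Finsupp.sum, map_sum]
  refine Submodule.sum_mem _ fun c hc => ?_
  obtain ⟨h1, h2⟩ := hx hc
  rw [← mul_one (x c), ← smul_eq_mul, ← Finsupp.smul_single, map_smul]
  refine Submodule.smul_mem _ _ (Finsupp.supported_mono ?_ (h c))
  rintro c' ⟨h3, h4⟩
  exact ⟨by omega, by omega⟩

/-- The shift by one in the filtration is needed only for single vertices, which have length 0 and
are sent to sums of edges. On longer tuples the geodesic condition keeps the length from growing. -/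
theorem chainHomotopy_mem (hE : IsGeodesicChoice R (G := G) w E) {p n : ℤ} {x : RC R G}
    (hx : x ∈ RCfil R G p n) : chainHomotopy R G w E x ∈ RCfil R G (p + 1) (n + 1) := by
  refine map_mem_RCfil R G (fun c => ?_) hx
  have hc := c.isChain_reach
  have h1 : chainHomotopy R G w E (Finsupp.single c 1) =
      chainL R G (pathHomotopy R w E c.toList) := by simp [chainHomotopy]
  rw [h1]
  refine chainL_mem_RCfil R G (p := c.length + 1) ?_
  push_cast
  rw [c.coe_length]
  unfold Tuple.deg
  generalize c.toList = l at hc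
  match l with
  | [] => simp [pathHomotopy]
  | [x] =>
    refine Submodule.neg_mem _ (attach_mem_supported R (hE.mem x w (hE.reach x)) ?_)
    rintro p ⟨-, -, h, -⟩
    simpa [tupleLength] using h
  | x :: y :: l =>
    rw [List.isChain_cons_cons] at hc
    refine Submodule.neg_mem _ (attach_mem_supported R (hE.mem x y hc.1) ?_)
    rintro p ⟨-, -, -, h⟩
    refine ⟨by simp, le_trans ?_ le_self_add⟩
    simp only [tupleLength, ← add_assoc]
    gcongr

end Reachability

/-! ### Computing pages from a contraction -/

namespace FilteredComplex

variable {R : Type u} [CommRing R] {M : Type v} [AddCommGroup M] [Module R M]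
  (K : FilteredComplex R M)

/-- If `P` is homotopic to the identity by a homotopy that raises the filtration by at most one,
then `x` and `P x` have the same class in all pages from the second on. -/
theorem sub_mem_B {h P : M →ₗ[R] M} (hh : ∀ p n x, x ∈ K.F p n → h x ∈ K.F (p + 1) (n + 1))
    (hP : ∀ p n x, x ∈ K.F p n → P x ∈ K.F p n)
    (hdh : ∀ x, K.d (h x) + h (K.d x) = x - P x) {r p n : ℤ} (hr : 2 ≤ r) {x : M}
    (hx : x ∈ K.A r p n) : x - P x ∈ K.B r p n := by
  obtain ⟨h1, h2⟩ := hx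
  replace h2 : K.d x ∈ K.F (p - r) (n - 1) := h2
  have h3 := hh _ _ _ h1
  have h4 := hh _ _ _ h2
  rw [sub_add_cancel n 1] at h4
  rw [← hdh, add_comm]
  -- Here `h x` lies in filtration `p + 1 ≤ p + r - 1` and `h (d x)` in filtration `p - r + 1 ≤ p -
  -- 1`; both inequalities amount to `2 ≤ r`.
  refine Submodule.add_mem_sup ⟨K.F_mono (by omega) _ h4, ?_⟩
    ⟨h x, ⟨K.F_mono (by omega) _ h3, ?_⟩, rfl⟩
  · have h5 : K.d (h (K.d x)) = K.d x - P (K.d x) := by simpa [K.d_d] using hdh (K.d x)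
    change K.d (h (K.d x)) ∈ K.F (p - 1 - (r - 1)) (n - 1)
    rw [h5, show p - 1 - (r - 1) = p - r by ring]
    exact Submodule.sub_mem _ h2 (hP _ _ _ h2)
  · have h5 : K.d (h x) = x - P x - h (K.d x) := eq_sub_of_add_eq (hdh x)
    change K.d (h x) ∈ K.F (p + r - 1 - (r - 1)) (n + 1 - 1)
    rw [h5, show p + r - 1 - (r - 1) = p by ring,
      show n + 1 - 1 = n by ring]
    exact Submodule.sub_mem _ (Submodule.sub_mem _ h1 (hP _ _ _ h1))
      (K.F_mono (by omega) _ h4)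

theorem subsingleton_page {r : ℕ} {p n : ℤ} (h : ∀ x ∈ K.A r p n, x ∈ K.B r p n) :
    Subsingleton (K.page r p n) :=
  Submodule.Quotient.subsingleton_iff.2 <| eq_top_iff.2 fun x _ => h x x.2

theorem exists_page_equiv {r : ℕ} {p n : ℤ} (φ : M →ₗ[R] R) (hφ : ∀ x ∈ K.B r p n, φ x = 0) {w : M}
    (hw : w ∈ K.A r p n) (hφw : φ w = 1) (h : ∀ x ∈ K.A r p n, x - φ x • w ∈ K.B r p n) :
    ∃ e : K.page r p n ≃ₗ[R] R, ∀ x : K.A r p n, e (K.cls r p n x) = φ x := by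
  let f : K.page r p n →ₗ[R] R :=
    Submodule.liftQ _ (φ ∘ₗ (K.A r p n).subtype) fun x hx => hφ x hx
  have hf : ∀ x : K.A r p n, f (K.cls r p n x) = φ x := fun x => rfl
  refine ⟨LinearEquiv.ofBijective f ⟨?_, fun c => ⟨K.cls r p n (c • ⟨w, hw⟩), ?_⟩⟩, hf⟩
  · rw [← LinearMap.ker_eq_bot, LinearMap.ker_eq_bot']
    intro y hy
    obtain ⟨x, rfl⟩ := Submodule.mkQ_surjective _ y
    have h1 : φ x = 0 := hy
    have h2 := h x x.2
    rw [h1, zero_smul, sub_zero] at h2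
    exact (Submodule.Quotient.mk_eq_zero _).2 h2
  · rw [hf]
    simp [hφw]

end FilteredComplex

/-! ### Sums of coefficients of chains -/

section Coefficients

variable (R : Type u) [CommRing R] {V : Type v} (G : Digraph V)

/-- The sum of the coefficients of a chain, weighted by a function of the tuples. -/
noncomputable def weightedSum (s : List V → R) : RC R G →ₗ[R] R :=
  Finsupp.linearCombination R fun c : Tuple G => s c.toList

variable {R G}

theorem weightedSum_eq_zero {s : List V → R} {p n : ℤ}
    (hs : ∀ c : Tuple G, c.deg = n → (c.length : ℤ) ≤ p → s c.toList = 0) {x : RC R G}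
    (hx : x ∈ RCfil R G p n) : weightedSum R G s x = 0 := by
  unfold weightedSum
  rw [Finsupp.linearCombination_apply]
  refine Finset.sum_eq_zero fun c hc => ?_
  obtain ⟨h1, h2⟩ := hx hc
  simp only [hs c h1 h2, smul_zero]

/-- A weight that vanishes on tuples with repetitions can be evaluated on lists, before they are
turned into chains. -/
theorem weightedSum_chainL {s : List V → R} (h0 : s [] = 0)
    (hs : ∀ u a t, List.IsChain (Reach G) (u ++ a :: a :: t) → s (u ++ a :: a :: t) = 0)
    {f : List V →₀ R} (hf : f ∈ reachChains R G) :
    weightedSum R G s (chainL R G f) = Finsupp.linearCombination R s f := by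
  refine eqOn_reachChains R G (φ := weightedSum R G s ∘ₗ chainL R G) (fun l hl => ?_) hf
  simp only [LinearMap.comp_apply, chainL_single, Finsupp.linearCombination_single, one_smul]
  by_cases h : IsGenerator G l
  · simp [chainOf, h, weightedSum]
  · rw [chainOf, dif_neg h, map_zero]
    rcases eq_or_ne l [] with rfl | hne
    · exact h0.symm
    · obtain ⟨u, a, t, rfl⟩ := exists_repeat G hl fun h' => h ⟨hne, h'⟩
      exact (hs u a t hl).symm

theorem linearCombination_attach (s : List V → R) (e : V × V →₀ R) (l : List V) :
    Finsupp.linearCombination R s (attach R e (Finsupp.single l 1)) =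
      Finsupp.linearCombination R (fun p : V × V => s (p.1 :: p.2 :: l)) e := by
  have : Finsupp.linearCombination R s ∘ₗ (attach R).flip (Finsupp.single l 1) =
      Finsupp.linearCombination R (fun p : V × V => s (p.1 :: p.2 :: l)) := by
    refine Finsupp.lhom_ext' fun p => LinearMap.ext_ring ?_
    simp
  exact LinearMap.congr_fun this e

end Coefficients

theorem one_le_dist {V : Type v} {G : Digraph V} {x y : V} (h : x ≠ y) : 1 ≤ dist G x y := by
  refine le_iInf₂ fun k hk => ?_
  cases hk with
  | refl => exact absurd rfl h
  | cons _ _ => exact_mod_cast Nat.succ_le_succ (Nat.zero_le _)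

/-! ### Digraphs made of two intervals -/

section CycleModel

variable (R : Type u) [CommRing R] {V : Type v} (G : Digraph V) (w : V) (I : Set V)
  (Φ : V → (V × V →₀ R)) (γ : V × V →₀ R)

open Classical in
/-- The weight of a pair of vertices that enters `I`. -/
noncomputable def entering (x y : V) : R := if x ∉ I ∧ y ∈ I then 1 else 0

open Classical in
/-- The difference of the paths `Φ y` and `Φ x`, corrected by the loop `γ` if it leads from `I`
to `w`. -/
noncomputable def pathBetween (x y : V) : V × V →₀ R :=
  Φ y - Φ x + if x ∈ I ∧ y = w then γ else 0

open Classical in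
/-- The multiple of the loop that the paths from `x` to `y` to `z` and from `x` to `z` bound. -/
noncomputable def attachWeight (x y z : V) : R := if z = w then entering R I x y else 0

/-- The data of two directed intervals with common ends, where `w` is the final vertex, `I` is the
interior of the longer interval, of length `a`, and `Φ x` is a path from the initial vertex to `x`,
which avoids `I` if `x ∉ I`. The loop `γ` is the longer interval minus the other one. -/
structure IsCycleModel (a : ℕ) : Prop where
  notMem : w ∉ I
  reach : ∀ x, Reach G x w
  eq_of_reach : ∀ {x}, Reach G w x → x = w
  mem_or_eq : ∀ {x y}, Reach G x y → x ∈ I → y ∈ I ∨ y = w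
  edgeBoundary_path : ∃ o, ∀ x, edgeBoundary R (Φ x) = Finsupp.single x 1 - Finsupp.single o 1
  edgeBoundary_loop : edgeBoundary R γ = 0
  pathBetween_mem : ∀ x y, Reach G x y → pathBetween R w I Φ γ x y ∈ Finsupp.supported R R
    {e | Reach G e.1 e.2 ∧ Reach G e.2 y ∧ dist G e.1 e.2 ≤ 1 ∧
      dist G e.1 e.2 + dist G e.2 y ≤ dist G x y}
  loop_mem : γ ∈ Finsupp.supported R R
    {e | Reach G e.1 e.2 ∧ dist G e.1 e.2 ≤ 1 ∧ dist G e.1 e.2 + dist G e.2 w ≤ a}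
  loop_entering : I = ∅ ∨
    Finsupp.linearCombination R (fun e : V × V => entering R I e.1 e.2) γ = 1
  le_dist : ∀ {x y}, x ∉ I → y ∈ I → Reach G x y → a ≤ dist G x y + dist G y w

/-- The weight of the tuples of degree `0`. -/
def vertexWeight : List V → R
  | [_] => 1
  | _ => 0

/-- The weight of the tuples `(x, y)` that enter `I`. -/
noncomputable def edgeWeight : List V → R
  | [x, y] => entering R I x y
  | _ => 0

open Classical in
/-- The weight of the tuples `(x, y, w)` such that `(x, y)` enters `I`. -/
noncomputable def triangleWeight : List V → R
  | [x, y, z] => if z = w then entering R I x y else 0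
  | _ => 0

/-- The loop as a reachability chain. -/
noncomputable def loopChain : RC R G := chainL R G (attach R γ (Finsupp.single [] 1))

/-- The cone on the loop with apex `w`. -/
noncomputable def coneChain : RC R G := chainL R G (attach R γ (Finsupp.single [w] 1))

/-- The projection onto the span of `(w)`, the loop and its cone. -/
noncomputable def cycleProjection : RC R G →ₗ[R] RC R G :=
  (weightedSum R G (vertexWeight R)).smulRight (chainOf R G [w]) +
    (weightedSum R G (edgeWeight R I)).smulRight (loopChain R G γ) +
    (weightedSum R G (triangleWeight R w I)).smulRight (coneChain R G w γ)

theorem cycleProjection_apply (x : RC R G) : cycleProjection R G w I γ x =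
    weightedSum R G (vertexWeight R) x • chainOf R G [w] +
      weightedSum R G (edgeWeight R I) x • loopChain R G γ +
      weightedSum R G (triangleWeight R w I) x • coneChain R G w γ := rfl

variable {R G w I Φ γ} {a : ℕ}

theorem chainOf_repeat (x : V) (l : List V) : chainOf R G (x :: x :: l) = 0 := by
  have : ¬ IsGenerator G (x :: x :: l) := fun h => (List.isChain_cons_cons.1 h.2).1.1 rfl
  simp [chainOf, this]

namespace IsCycleModel

/-- The terms in `Φ` telescope, so only the corrections by `γ` matter. If `x ∈ I` then `y` stays in
`I` or is `w`, and the corrections cancel; if `x ∉ I`, the only possible correction is that of the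
path from `y` to `z`. -/
theorem pathDefect_eq (h : IsCycleModel R G w I Φ γ a) {x y z : V} (hxy : Reach G x y)
    (hyz : Reach G y z) : pathDefect R (pathBetween R w I Φ γ) x y z =
      attachWeight R w I x y z • γ := by
  unfold pathDefect pathBetween attachWeight entering
  have hw := h.notMem
  by_cases hx : x ∈ I
  · rcases h.mem_or_eq hxy hx with hy | rfl
    · have hyw : y ≠ w := fun e => hw (e ▸ hy)
      by_cases hz : z = w <;> simp [hx, hy, hyw, hz]; abel
    · obtain rfl := h.eq_of_reach hyz
      simp [hx, hw]
  · by_cases hy : y ∈ I <;> by_cases hz : z = w <;> simp [hx, hy, hz]; abel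

theorem isGeodesicChoice (h : IsCycleModel R G w I Φ γ a) :
    IsGeodesicChoice R (G := G) w (pathBetween R w I Φ γ) where
  reach := h.reach
  boundary_eq x y := by
    obtain ⟨o, ho⟩ := h.edgeBoundary_path
    unfold pathBetween
    split_ifs <;> simp [ho, h.edgeBoundary_loop]
  self x := by
    have : ¬ (x ∈ I ∧ x = w) := fun hx => h.notMem (hx.2 ▸ hx.1)
    simp [pathBetween, this]
  mem := h.pathBetween_mem

theorem chainL_pathProjection (h : IsCycleModel R G w I Φ γ a) (c : Tuple G) :
    chainL R G (pathProjection R w (pathBetween R w I Φ γ) c.toList) =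
      cycleProjection R G w I γ (Finsupp.single c 1) := by
  simp only [cycleProjection_apply, weightedSum, Finsupp.linearCombination_single, one_smul]
  obtain ⟨l, h0, hl⟩ := c
  dsimp only
  match l, h0, hl with
  | [x], _, _ => simp [pathProjection, vertexWeight, edgeWeight, triangleWeight]
  | [x, y], _, hl =>
    rw [List.isChain_cons_cons] at hl
    simp [pathProjection, vertexWeight, edgeWeight, triangleWeight, chainOf_repeat,
      h.pathDefect_eq hl.1.2 (h.reach y), attachWeight, loopChain]
  | [x, y, z], _, hl =>
    rw [List.isChain_cons_cons, List.isChain_cons_cons] at hl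
    simp only [pathProjection, vertexWeight, edgeWeight, triangleWeight, chainOf_repeat, map_add,
      List.headD_cons, h.pathDefect_eq hl.1.2 hl.2.1.2, chainL_single, zero_add, zero_smul,
      map_smul, LinearMap.smul_apply, attachWeight]
    by_cases hz : z = w
    · subst hz; rfl
    · simp [hz]
  | x :: y :: z :: t :: l, _, hl =>
    simp only [List.isChain_cons_cons] at hl
    -- No other vertex is reachable from `w`, so `w` can only be the last entry. Hence the
    -- projection vanishes in degrees above 2.
    have hz : z ≠ w := by
      rintro rfl
      exact hl.2.2.1.1 (h.eq_of_reach hl.2.2.1.2).symm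
    simp [pathProjection, vertexWeight, edgeWeight, triangleWeight, chainOf_repeat,
      h.pathDefect_eq hl.1.2 hl.2.1.2, attachWeight, hz]

theorem homotopy_eq (h : IsCycleModel R G w I Φ γ a) (x : RC R G) :
    boundary R G (chainHomotopy R G w (pathBetween R w I Φ γ) x) +
      chainHomotopy R G w (pathBetween R w I Φ γ) (boundary R G x) =
    x - cycleProjection R G w I γ x := by
  have : boundary R G ∘ₗ chainHomotopy R G w (pathBetween R w I Φ γ) +
      chainHomotopy R G w (pathBetween R w I Φ γ) ∘ₗ boundary R G =
      LinearMap.id - cycleProjection R G w I γ := by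
    refine Finsupp.lhom_ext' fun c => LinearMap.ext_ring ?_
    simp only [LinearMap.comp_apply, LinearMap.add_apply, LinearMap.sub_apply,
      LinearMap.id_apply, Finsupp.lsingle_apply]
    rw [boundary_chainHomotopy_add R G h.isGeodesicChoice, h.chainL_pathProjection]
  exact LinearMap.congr_fun this x

theorem attach_loop_mem (h : IsCycleModel R G w I Φ γ a) :
    attach R γ (Finsupp.single [] 1) ∈ reachChains R G :=
  attach_mem_supported R h.loop_mem fun p hp => by simpa using hp.1

theorem attach_cone_mem (h : IsCycleModel R G w I Φ γ a) :
    attach R γ (Finsupp.single [w] 1) ∈ reachChains R G :=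
  attach_mem_supported R h.loop_mem fun p hp => by simpa using ⟨hp.1, h.reach p.2⟩

theorem chainOf_mem_RCfil (w : V) : chainOf R G [w] ∈ RCfil R G 0 0 := by
  rw [← chainL_single]
  exact chainL_mem_RCfil R G (p := 0) (Finsupp.single_mem_supported R 1 (by simp [tupleLength]))

theorem loopChain_mem (h : IsCycleModel R G w I Φ γ a) : loopChain R G γ ∈ RCfil R G 1 1 := by
  refine chainL_mem_RCfil R G (p := 1) (attach_mem_supported R h.loop_mem fun p hp => ?_)
  simpa [tupleLength] using hp.2.1

theorem coneChain_mem (h : IsCycleModel R G w I Φ γ a) : coneChain R G w γ ∈ RCfil R G a 2 := by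
  refine chainL_mem_RCfil R G (p := a) (attach_mem_supported R h.loop_mem fun p hp => ?_)
  simpa [tupleLength] using hp.2.2

theorem boundary_chainOf_singleton (w : V) : boundary R G (chainOf R G [w]) = 0 := by
  have h0 : ¬ IsGenerator G ([] : List V) := fun h => h.1 rfl
  rw [boundary_chainOf R G (by simp)]
  simp [faces, chainOf, h0]

theorem boundary_loopChain (h : IsCycleModel R G w I Φ γ a) :
    boundary R G (loopChain R G γ) = 0 := by
  rw [loopChain, boundary_chainL R G h.attach_loop_mem, facesL_attach, h.edgeBoundary_loop]
  simp [faces]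

theorem boundary_coneChain (h : IsCycleModel R G w I Φ γ a) :
    boundary R G (coneChain R G w γ) = loopChain R G γ := by
  rw [coneChain, boundary_chainL R G h.attach_cone_mem, facesL_attach, h.edgeBoundary_loop]
  simp [faces, loopChain]

theorem vertexWeight_chainL {f : List V →₀ R} (hf : f ∈ reachChains R G) :
    weightedSum R G (vertexWeight R) (chainL R G f) =
      Finsupp.linearCombination R (vertexWeight R) f := by
  refine weightedSum_chainL rfl (fun u b t _ => ?_) hf
  rcases u with _ | ⟨u, _ | ⟨u', v⟩⟩ <;> rfl

theorem edgeWeight_chainL {f : List V →₀ R} (hf : f ∈ reachChains R G) :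
    weightedSum R G (edgeWeight R I) (chainL R G f) =
      Finsupp.linearCombination R (edgeWeight R I) f := by
  refine weightedSum_chainL rfl (fun u b t _ => ?_) hf
  rcases u with _ | ⟨u, _ | ⟨u', v⟩⟩
  · rcases t with _ | ⟨t, t'⟩
    · simp [edgeWeight, entering]
    · rfl
  · rfl
  · rcases v with _ | _ <;> rfl

theorem triangleWeight_chainL (h : IsCycleModel R G w I Φ γ a) {f : List V →₀ R}
    (hf : f ∈ reachChains R G) :
    weightedSum R G (triangleWeight R w I) (chainL R G f) =
      Finsupp.linearCombination R (triangleWeight R w I) f := by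
  refine weightedSum_chainL rfl (fun u b t _ => ?_) hf
  rcases u with _ | ⟨u, _ | ⟨u', _ | ⟨u'', v⟩⟩⟩
  · rcases t with _ | ⟨t, _ | ⟨t', t''⟩⟩
    · rfl
    · simp [triangleWeight, entering]
    · rfl
  · rcases t with _ | ⟨t, t'⟩
    · simp only [List.cons_append, List.nil_append, triangleWeight, entering]
      split_ifs with h1 h2
      -- The tuple `(u, w, w)` has weight zero because its first step ends in `w`, outside `I`.
      · exact absurd (h1 ▸ h2.2) h.notMem
      · rfl
      · rfl
    · rfl
  · rfl
  · rcases v with _ | _ <;> rfl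

theorem edgeWeight_loopChain (h : IsCycleModel R G w I Φ γ a) :
    weightedSum R G (edgeWeight R I) (loopChain R G γ) =
      Finsupp.linearCombination R (fun e : V × V => entering R I e.1 e.2) γ := by
  rw [loopChain, edgeWeight_chainL h.attach_loop_mem, linearCombination_attach]
  rfl

theorem triangleWeight_coneChain (h : IsCycleModel R G w I Φ γ a) :
    weightedSum R G (triangleWeight R w I) (coneChain R G w γ) =
      Finsupp.linearCombination R (fun e : V × V => entering R I e.1 e.2) γ := by
  rw [coneChain, h.triangleWeight_chainL h.attach_cone_mem, linearCombination_attach]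
  simp [triangleWeight]

theorem vertexWeight_chainOf (w : V) :
    weightedSum R G (vertexWeight R) (chainOf R G [w]) = 1 := by
  rw [← chainL_single, vertexWeight_chainL (Finsupp.single_mem_supported R 1 (by simp))]
  simp [vertexWeight]

theorem vertexWeight_eq_zero {p n : ℤ} {x : RC R G} (hx : x ∈ RCfil R G p n)
    (hpn : ¬ (n = 0 ∧ 0 ≤ p)) : weightedSum R G (vertexWeight R) x = 0 := by
  refine weightedSum_eq_zero (fun c hd hl => ?_) hx
  generalize c.length = k at hl
  obtain ⟨l, h0, hc⟩ := c
  dsimp only at *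
  unfold vertexWeight
  split
  · simp [Tuple.deg] at hd
    omega
  · rfl

theorem edgeWeight_eq_zero {p n : ℤ} {x : RC R G} (hx : x ∈ RCfil R G p n)
    (hpn : ¬ (n = 1 ∧ 1 ≤ p)) : weightedSum R G (edgeWeight R I) x = 0 := by
  refine weightedSum_eq_zero (fun c hd hl => ?_) hx
  have hlen := c.coe_length
  generalize c.length = k at hl hlen
  obtain ⟨l, h0, hc⟩ := c
  dsimp only at *
  unfold edgeWeight
  split
  · rename_i y z
    have h1 : (1 : ℕ∞) ≤ k := by
      rw [hlen]
      simpa [tupleLength] using one_le_dist (List.isChain_cons_cons.1 hc).1.1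
    have h2 : 1 ≤ k := by exact_mod_cast h1
    simp [Tuple.deg] at hd
    omega
  · rfl

/-- A tuple `(x, y, w)` that enters `I` at `y` has length at least `a`, by `le_dist`. This prevents
the cone class from being represented in lower filtration. -/
theorem triangleWeight_eq_zero (h : IsCycleModel R G w I Φ γ a) {p n : ℤ} {x : RC R G}
    (hx : x ∈ RCfil R G p n) (hpn : ¬ (n = 2 ∧ a ≤ p)) :
    weightedSum R G (triangleWeight R w I) x = 0 := by
  refine weightedSum_eq_zero (fun c hd hl => ?_) hx
  have hlen := c.coe_length
  generalize c.length = k at hl hlen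
  obtain ⟨l, h0, hc⟩ := c
  dsimp only at *
  unfold triangleWeight
  split
  · rename_i y z t
    unfold entering
    split_ifs with h1 h2
    · subst h1
      have h3 : (a : ℕ∞) ≤ k := by
        rw [hlen]
        simpa [tupleLength] using h.le_dist h2.1 h2.2 (List.isChain_cons_cons.1 hc).1.2
      have h4 : a ≤ k := by exact_mod_cast h3
      simp [Tuple.deg] at hd
      omega
    · rfl
    · rfl
  · rfl

theorem cycleProjection_mem (h : IsCycleModel R G w I Φ γ a) {p n : ℤ} {x : RC R G}
    (hx : x ∈ RCfil R G p n) : cycleProjection R G w I γ x ∈ RCfil R G p n := by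
  have mono : ∀ {p q n : ℤ}, p ≤ q → RCfil R G p n ≤ RCfil R G q n := fun hpq =>
    (filteredRC R G).F_mono hpq _
  rw [cycleProjection_apply]
  refine Submodule.add_mem _ (Submodule.add_mem _ ?_ ?_) ?_
  · by_cases hpn : n = 0 ∧ 0 ≤ p
    · obtain ⟨rfl, hp⟩ := hpn
      exact Submodule.smul_mem _ _ (mono hp (chainOf_mem_RCfil w))
    · rw [vertexWeight_eq_zero hx hpn, zero_smul]
      exact Submodule.zero_mem _
  · by_cases hpn : n = 1 ∧ 1 ≤ p
    · obtain ⟨rfl, hp⟩ := hpn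
      exact Submodule.smul_mem _ _ (mono hp h.loopChain_mem)
    · rw [edgeWeight_eq_zero hx hpn, zero_smul]
      exact Submodule.zero_mem _
  · by_cases hpn : n = 2 ∧ a ≤ p
    · obtain ⟨rfl, hp⟩ := hpn
      exact Submodule.smul_mem _ _ (mono hp h.coneChain_mem)
    · rw [h.triangleWeight_eq_zero hx hpn, zero_smul]
      exact Submodule.zero_mem _

/-- A map homotopic to the identity commutes with the boundary, and of the three generators of its
image only the cone has a boundary, namely the loop. -/
theorem boundary_cycleProjection (h : IsCycleModel R G w I Φ γ a) (x : RC R G) :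
    weightedSum R G (triangleWeight R w I) x • loopChain R G γ =
      cycleProjection R G w I γ (boundary R G x) := by
  have h1 := congrArg (boundary R G) (h.homotopy_eq x)
  have h2 := h.homotopy_eq (boundary R G x)
  rw [map_add, boundary_boundary, zero_add, map_sub] at h1
  rw [boundary_boundary, map_zero, add_zero, h1] at h2
  rw [← sub_right_injective h2, cycleProjection_apply]
  simp [boundary_chainOf_singleton, h.boundary_loopChain, h.boundary_coneChain]

/-- Each identity follows by applying the weight to `boundary_cycleProjection`, since the weights
are dual to the three generators. If `I` is empty, the last two weights are zero. -/
theorem weightedSum_boundary (h : IsCycleModel R G w I Φ γ a) (x : RC R G) :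
    weightedSum R G (vertexWeight R) (boundary R G x) = 0 ∧
    weightedSum R G (edgeWeight R I) (boundary R G x) =
      weightedSum R G (triangleWeight R w I) x ∧
    weightedSum R G (triangleWeight R w I) (boundary R G x) = 0 := by
  have key := h.boundary_cycleProjection x
  rw [cycleProjection_apply] at key
  refine ⟨?_, ?_⟩
  · have := congrArg (weightedSum R G (vertexWeight R)) key
    simpa [vertexWeight_chainOf, vertexWeight_eq_zero h.loopChain_mem,
      vertexWeight_eq_zero h.coneChain_mem] using this.symm
  · rcases h.loop_entering with hI | hγ
    · have h1 : edgeWeight R I = 0 := by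
        funext l
        unfold edgeWeight
        split <;> simp [entering, hI]
      have h2 : triangleWeight R w I = 0 := by
        funext l
        unfold triangleWeight
        split <;> simp [entering, hI]
      simp [h1, h2, weightedSum, Finsupp.linearCombination_apply]
    · constructor
      · have := congrArg (weightedSum R G (edgeWeight R I)) key
        simpa [h.edgeWeight_loopChain, hγ, edgeWeight_eq_zero (chainOf_mem_RCfil w),
          edgeWeight_eq_zero h.coneChain_mem] using this.symm
      · have := congrArg (weightedSum R G (triangleWeight R w I)) key
        simpa [h.triangleWeight_coneChain, hγ, h.triangleWeight_eq_zero (chainOf_mem_RCfil w),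
          h.triangleWeight_eq_zero h.loopChain_mem] using this.symm

end IsCycleModel

end CycleModel

/-! ### The pages of the spectral sequence of a cycle -/

namespace IsCycleModel

variable {R : Type u} [CommRing R] {V : Type v} {G : Digraph V} {w : V} {I : Set V}
  {Φ : V → (V × V →₀ R)} {γ : V × V →₀ R} {a : ℕ}

theorem sub_cycleProjection_mem_B (h : IsCycleModel R G w I Φ γ a) {r p n : ℤ} (hr : 2 ≤ r)
    {x : RC R G} (hx : x ∈ (filteredRC R G).A r p n) :
    x - cycleProjection R G w I γ x ∈ (filteredRC R G).B r p n :=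
  (filteredRC R G).sub_mem_B (fun _ _ _ => chainHomotopy_mem R G h.isGeodesicChoice)
    (fun _ _ _ => h.cycleProjection_mem) h.homotopy_eq hr hx

theorem mem_A {r p n q q' : ℤ} {x : RC R G} (hx : x ∈ RCfil R G q n) (hq : q ≤ p)
    (hd : boundary R G x ∈ RCfil R G q' (n - 1)) (hq' : q' ≤ p - r) :
    x ∈ (filteredRC R G).A r p n :=
  ⟨(filteredRC R G).F_mono hq n hx, (filteredRC R G).F_mono hq' (n - 1) hd⟩

theorem chainOf_mem_A {r p : ℤ} (hp : 0 ≤ p) :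
    chainOf R G [w] ∈ (filteredRC R G).A r p 0 :=
  mem_A (q' := p - r) (chainOf_mem_RCfil w) hp
    (by rw [boundary_chainOf_singleton]; exact Submodule.zero_mem _) le_rfl

theorem loopChain_mem_A (h : IsCycleModel R G w I Φ γ a) {r p : ℤ} (hp : 1 ≤ p) :
    loopChain R G γ ∈ (filteredRC R G).A r p 1 :=
  mem_A (q' := p - r) h.loopChain_mem hp
    (by rw [h.boundary_loopChain]; exact Submodule.zero_mem _) le_rfl

theorem coneChain_mem_A (h : IsCycleModel R G w I Φ γ a) {r p : ℤ} (hp : a ≤ p) (hr : 1 ≤ p - r) :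
    coneChain R G w γ ∈ (filteredRC R G).A r p 2 :=
  mem_A h.coneChain_mem hp (by rw [h.boundary_coneChain]; exact h.loopChain_mem) hr

theorem mem_B_of_mem_A {r p n : ℤ} {x : RC R G} (hx : x ∈ (filteredRC R G).A (r - 1) (p - 1) n) :
    x ∈ (filteredRC R G).B r p n :=
  Submodule.mem_sup_left hx

theorem eq_zero_of_mem_B {φ : RC R G →ₗ[R] R} {r p n : ℤ}
    (h1 : ∀ x ∈ RCfil R G (p - 1) n, φ x = 0)
    (h2 : ∀ x ∈ RCfil R G (p + r - 1) (n + 1), φ (boundary R G x) = 0) {x : RC R G}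
    (hx : x ∈ (filteredRC R G).B r p n) : φ x = 0 := by
  obtain ⟨y, hy, _, ⟨z, hz, rfl⟩, rfl⟩ := Submodule.mem_sup.1 hx
  rw [map_add, h1 y hy.1, zero_add]
  exact h2 z hz.1

/-- Outside the bidegrees of `(w)`, the loop and its cone, the pages vanish, and the last two
classes do not survive to page `a`. -/
theorem subsingleton_page (h : IsCycleModel R G w I Φ γ a) {r : ℕ} (hr : 2 ≤ r) {p n : ℤ}
    (h0 : ¬ (p = 0 ∧ n = 0)) (h12 : a ≤ r ∨ (¬ (p = 1 ∧ n = 1) ∧ ¬ (p = a ∧ n = 2))) :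
    Subsingleton ((filteredRC R G).page r p n) := by
  refine FilteredComplex.subsingleton_page _ fun x hx => ?_
  have hr' : (2 : ℤ) ≤ r := by exact_mod_cast hr
  rw [← sub_add_cancel x (cycleProjection R G w I γ x)]
  refine Submodule.add_mem _ (h.sub_cycleProjection_mem_B hr' hx) ?_
  have hxF : x ∈ RCfil R G p n := hx.1
  have hxd : boundary R G x ∈ RCfil R G (p - r) (n - 1) := hx.2
  rw [cycleProjection_apply]
  refine Submodule.add_mem _ (Submodule.add_mem _ ?_ ?_) ?_
  · by_cases hpn : n = 0 ∧ 0 ≤ p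
    · obtain ⟨rfl, hp⟩ := hpn
      exact Submodule.smul_mem _ _ (mem_B_of_mem_A (chainOf_mem_A (by omega)))
    · rw [vertexWeight_eq_zero hxF hpn, zero_smul]
      exact Submodule.zero_mem _
  · by_cases hpn : n = 1 ∧ 1 ≤ p
    · obtain ⟨rfl, hp⟩ := hpn
      refine Submodule.smul_mem _ _ ?_
      by_cases hp1 : p = 1
      -- In filtration 1 the loop is killed by the cone, which is admissible there because `a ≤ p +
      -- r - 1 = r`.
      · have har : a ≤ r := by omega
        exact Submodule.mem_sup_right
          ⟨coneChain R G w γ, h.coneChain_mem_A (by omega) (by omega), h.boundary_coneChain⟩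
      · exact mem_B_of_mem_A (h.loopChain_mem_A (by omega))
    · rw [edgeWeight_eq_zero hxF hpn, zero_smul]
      exact Submodule.zero_mem _
  · by_cases hpn : n = 2 ∧ a ≤ p
    · obtain ⟨rfl, hp⟩ := hpn
      -- If `p ≤ r`, the boundary of `x` has filtration at most 0, so it has no edge terms, and the
      -- coefficient of the cone in the projection of `x` vanishes. If `p > r`, the hypotheses force
      -- `a < p`, and the cone already lies in filtration `p - 1`.
      by_cases hrp : p ≤ r
      · rw [← (h.weightedSum_boundary x).2.1, edgeWeight_eq_zero hxd (by omega), zero_smul]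
        exact Submodule.zero_mem _
      · exact Submodule.smul_mem _ _ (mem_B_of_mem_A (h.coneChain_mem_A (by omega) (by omega)))
    · rw [h.triangleWeight_eq_zero hxF hpn, zero_smul]
      exact Submodule.zero_mem _

theorem page_zero_equiv (h : IsCycleModel R G w I Φ γ a) {r : ℕ} (hr : 2 ≤ r) :
    ∃ e : (filteredRC R G).page r 0 0 ≃ₗ[R] R, ∀ x : (filteredRC R G).A r 0 0,
      e ((filteredRC R G).cls r 0 0 x) = weightedSum R G (vertexWeight R) x := by
  refine FilteredComplex.exists_page_equiv _ _ (fun x hx => ?_) (chainOf_mem_A le_rfl)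
    (vertexWeight_chainOf w) fun x hx => ?_
  · exact eq_zero_of_mem_B (fun y hy => vertexWeight_eq_zero hy (by omega))
      (fun y _ => (h.weightedSum_boundary y).1) hx
  · have := h.sub_cycleProjection_mem_B (by exact_mod_cast hr) hx
    have hxF : x ∈ RCfil R G 0 0 := hx.1
    rwa [cycleProjection_apply, edgeWeight_eq_zero hxF (by omega),
      h.triangleWeight_eq_zero hxF (by omega), zero_smul, zero_smul, add_zero, add_zero] at this

theorem page_loop_equiv (h : IsCycleModel R G w I Φ γ a) (hI : I.Nonempty) {r : ℕ} (hr : 2 ≤ r)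
    (hra : r < a) :
    ∃ e : (filteredRC R G).page r 1 1 ≃ₗ[R] R, ∀ x : (filteredRC R G).A r 1 1,
      e ((filteredRC R G).cls r 1 1 x) = weightedSum R G (edgeWeight R I) x := by
  refine FilteredComplex.exists_page_equiv _ _ (fun x hx => ?_) (h.loopChain_mem_A le_rfl)
    (h.edgeWeight_loopChain.trans (h.loop_entering.resolve_left hI.ne_empty)) fun x hx => ?_
  · refine eq_zero_of_mem_B (fun y hy => edgeWeight_eq_zero hy (by omega)) (fun y hy => ?_) hx
    -- The boundaries to be killed come from filtration `r < a`, too low for the triangle weight to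
    -- be nonzero.
    rw [(h.weightedSum_boundary y).2.1, h.triangleWeight_eq_zero hy (by omega)]
  · have := h.sub_cycleProjection_mem_B (by exact_mod_cast hr) hx
    have hxF : x ∈ RCfil R G 1 1 := hx.1
    rwa [cycleProjection_apply, vertexWeight_eq_zero hxF (by omega),
      h.triangleWeight_eq_zero hxF (by omega), zero_smul, zero_smul, add_zero, zero_add] at this

theorem page_cone_equiv (h : IsCycleModel R G w I Φ γ a) (hI : I.Nonempty) {r : ℕ} (hr : 2 ≤ r)
    (hra : r < a) :
    ∃ e : (filteredRC R G).page r a 2 ≃ₗ[R] R, ∀ x : (filteredRC R G).A r a 2,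
      e ((filteredRC R G).cls r a 2 x) = weightedSum R G (triangleWeight R w I) x := by
  refine FilteredComplex.exists_page_equiv _ _ (fun x hx => ?_)
    (h.coneChain_mem_A le_rfl (by omega))
    (h.triangleWeight_coneChain.trans (h.loop_entering.resolve_left hI.ne_empty)) fun x hx => ?_
  · exact eq_zero_of_mem_B (fun y hy => h.triangleWeight_eq_zero hy (by omega))
      (fun y _ => (h.weightedSum_boundary y).2.2) hx
  · have := h.sub_cycleProjection_mem_B (by exact_mod_cast hr) hx
    have hxF : x ∈ RCfil R G a 2 := hx.1
    rwa [cycleProjection_apply, vertexWeight_eq_zero hxF (by omega),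
      edgeWeight_eq_zero hxF (by omega), zero_smul, zero_smul, zero_add, zero_add] at this

theorem diff_eq_zero (h : IsCycleModel R G w I Φ γ a) {r : ℕ} (hr : 2 ≤ r) (hra : r + 1 < a)
    (p n : ℤ) : (filteredRC R G).diff r p n = 0 := by
  by_cases hs : Subsingleton ((filteredRC R G).page r p n)
  · exact LinearMap.ext fun x => by rw [Subsingleton.elim x 0, map_zero, map_zero]
  · have hpn : (p = 0 ∧ n = 0) ∨ (p = 1 ∧ n = 1) ∨ (p = a ∧ n = 2) := by
      by_contra hc
      push Not at hc
      exact hs (h.subsingleton_page hr (by tauto) (by tauto))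
    -- From the cone the target has filtration `a - r > 1` in degree 1; from the loop it has
    -- filtration `1 - r < 0` in degree 0. Neither is a surviving bidegree.
    have ht : Subsingleton ((filteredRC R G).page r (p - r) (n - 1)) :=
      h.subsingleton_page hr (by omega) (by omega)
    exact LinearMap.ext fun x => Subsingleton.elim _ _

theorem exists_page_equiv_page (h : IsCycleModel R G w I Φ γ a) (hI : I.Nonempty) {r s : ℕ}
    (hr : 2 ≤ r) (hrs : r ≤ s) (hs : s < a) (p n : ℤ) :
    ∃ e : (filteredRC R G).page s p n ≃ₗ[R] (filteredRC R G).page r p n,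
      ∀ x : (filteredRC R G).A s p n,
        e ((filteredRC R G).cls s p n x) = (filteredRC R G).cls r p n
          (Submodule.inclusion ((filteredRC R G).A_anti (Int.ofNat_le.2 hrs) p n) x) := by
  have of_functional : ∀ φ : RC R G →ₗ[R] R, (∀ t : ℕ, 2 ≤ t → t < a →
      ∃ e : (filteredRC R G).page t p n ≃ₗ[R] R, ∀ x : (filteredRC R G).A t p n,
        e ((filteredRC R G).cls t p n x) = φ x) →
      ∃ e : (filteredRC R G).page s p n ≃ₗ[R] (filteredRC R G).page r p n,
        ∀ x : (filteredRC R G).A s p n,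
          e ((filteredRC R G).cls s p n x) = (filteredRC R G).cls r p n
            (Submodule.inclusion ((filteredRC R G).A_anti (Int.ofNat_le.2 hrs) p n) x) := by
    intro φ hφ
    obtain ⟨e, he⟩ := hφ r hr (hrs.trans_lt hs)
    obtain ⟨e', he'⟩ := hφ s (hr.trans hrs) hs
    refine ⟨e'.trans e.symm, fun x => ?_⟩
    rw [LinearEquiv.trans_apply, LinearEquiv.symm_apply_eq, he, he']
    rfl
  by_cases h0 : p = 0 ∧ n = 0
  · obtain ⟨rfl, rfl⟩ := h0
    exact of_functional _ fun t ht _ => h.page_zero_equiv ht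
  by_cases h1 : p = 1 ∧ n = 1
  · obtain ⟨rfl, rfl⟩ := h1
    exact of_functional _ fun t ht hta => h.page_loop_equiv hI ht hta
  by_cases h2 : p = a ∧ n = 2
  · obtain ⟨rfl, rfl⟩ := h2
    exact of_functional _ fun t ht hta => h.page_cone_equiv hI ht hta
  have := h.subsingleton_page hr h0 (Or.inr ⟨h1, h2⟩)
  have := h.subsingleton_page (hr.trans hrs) h0 (Or.inr ⟨h1, h2⟩)
  exact ⟨0, fun x => Subsingleton.elim _ _⟩

end IsCycleModel

/-! ### Digraphs that are unions of two intervals -/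

section TwoIntervals

variable (R : Type u) [CommRing R] {V : Type v}

theorem HasPath.dist_le {G : Digraph V} {k : ℕ} {x y : V} (h : HasPath G k x y) :
    dist G x y ≤ k :=
  iInf₂_le (f := fun (k : ℕ) (_ : HasPath G k x y) => (k : ℕ∞)) k h

theorem le_dist_of_forall {G : Digraph V} {k : ℕ} {x y : V}
    (h : ∀ k', HasPath G k' x y → k ≤ k') : (k : ℕ∞) ≤ dist G x y :=
  le_iInf₂ fun k' hk' => by exact_mod_cast h k' hk'

/-- The digraph `G` is the union of two directed intervals, with vertices `α 0, …, α a` and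
`β 0, …, β b`, which have common ends and are otherwise disjoint. -/
structure IsTwoIntervals (G : Digraph V) (a b : ℕ) (α β : ℕ → V) : Prop where
  start : α 0 = β 0
  finish : α a = β b
  cover : ∀ x, (∃ i ≤ a, x = α i) ∨ ∃ j ≤ b, x = β j
  inj_left : ∀ {i j}, i ≤ a → j ≤ a → α i = α j → i = j
  inj_right : ∀ {i j}, i ≤ b → j ≤ b → β i = β j → i = j
  ends : ∀ {i j}, i ≤ a → j ≤ b → α i = β j → (i = 0 ∧ j = 0) ∨ (i = a ∧ j = b)
  adj : ∀ x y, G.Adj x y ↔ (∃ t < a, x = α t ∧ y = α (t + 1)) ∨ ∃ t < b, x = β t ∧ y = β (t + 1)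

/-- The sum of the edges `(δ t, δ (t + 1))` for `i ≤ t < j`. -/
noncomputable def arc (δ : ℕ → V) (i j : ℕ) : V × V →₀ R :=
  ∑ t ∈ Finset.Ico i j, Finsupp.single (δ t, δ (t + 1)) 1

open Classical in
/-- The path from the common start to a vertex, along the interval `β` if possible. -/
noncomputable def pathTo (a b : ℕ) (α β : ℕ → V) (x : V) : V × V →₀ R :=
  if h : ∃ j ≤ b, x = β j then arc R β 0 h.choose
  else if h : ∃ i ≤ a, x = α i then arc R α 0 h.choose else 0

/-- The interior of an interval. -/
def arcInterior (a : ℕ) (α : ℕ → V) : Set V := {x | ∃ i, 0 < i ∧ i < a ∧ x = α i}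

theorem edgeBoundary_arc (δ : ℕ → V) {i j : ℕ} (hij : i ≤ j) :
    edgeBoundary R (arc R δ i j) = Finsupp.single (δ j) 1 - Finsupp.single (δ i) 1 := by
  unfold arc
  rw [map_sum]
  simp only [edgeBoundary_single]
  exact Finset.sum_Ico_sub (fun t => Finsupp.single (δ t) (1 : R)) hij

theorem arc_mem_supported {δ : ℕ → V} {i j : ℕ} {s : Set (V × V)}
    (h : ∀ t, i ≤ t → t < j → (δ t, δ (t + 1)) ∈ s) : arc R δ i j ∈ Finsupp.supported R R s :=
  Submodule.sum_mem _ fun t ht => Finsupp.single_mem_supported R 1 <|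
    h t (Finset.mem_Ico.1 ht).1 (Finset.mem_Ico.1 ht).2

theorem arc_sub_arc (δ : ℕ → V) {i j : ℕ} (hij : i ≤ j) :
    arc R δ 0 j - arc R δ 0 i = arc R δ i j := by
  rw [sub_eq_iff_eq_add', arc, arc, arc, Finset.sum_Ico_consecutive _ (Nat.zero_le i) hij]

namespace IsTwoIntervals

variable {G : Digraph V} {a b : ℕ} {α β : ℕ → V}

/-- A path stays in one interval. After an edge it is no longer at the common start, so it can meet
the other interval only at the common finish, where the rest of the path has length 0. -/
theorem eq_of_hasPath (h : IsTwoIntervals G a b α β) {k : ℕ} {x y : V} (hp : HasPath G k x y) :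
    (∃ i, i + k ≤ a ∧ x = α i ∧ y = α (i + k)) ∨ ∃ i, i + k ≤ b ∧ x = β i ∧ y = β (i + k) := by
  induction hp with
  | refl x => simpa using h.cover x
  | @cons k x y z e _ ih =>
    rcases (h.adj x y).1 e with ⟨t, ht, rfl, hy⟩ | ⟨t, ht, rfl, hy⟩
    · refine Or.inl ⟨t, ?_⟩
      rcases ih with ⟨i, hi, hy', rfl⟩ | ⟨i, hi, hy', rfl⟩
      · obtain rfl := h.inj_left (by omega) (by omega) (hy.symm.trans hy')
        exact ⟨by omega, rfl, by congr 1; omega⟩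
      · rcases h.ends (by omega) (by omega) (hy.symm.trans hy') with hti | hti
        · omega
        · obtain rfl : k = 0 := by omega
          exact ⟨by omega, rfl, by rw [zero_add, ← hy, hy', add_zero]⟩
    · refine Or.inr ⟨t, ?_⟩
      rcases ih with ⟨i, hi, hy', rfl⟩ | ⟨i, hi, hy', rfl⟩
      · rcases h.ends (by omega) (by omega) (hy'.symm.trans hy) with hti | hti
        · omega
        · obtain rfl : k = 0 := by omega
          exact ⟨by omega, rfl, by rw [zero_add, ← hy, hy', add_zero]⟩
      · obtain rfl := h.inj_right (by omega) (by omega) (hy.symm.trans hy')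
        exact ⟨by omega, rfl, by congr 1; omega⟩

theorem hasPath_left (h : IsTwoIntervals G a b α β) {i j : ℕ} (hij : i ≤ j) (hj : j ≤ a) :
    HasPath G (j - i) (α i) (α j) := by
  obtain ⟨k, rfl⟩ := Nat.exists_eq_add_of_le hij
  rw [Nat.add_sub_cancel_left]
  clear hij
  induction k generalizing i with
  | zero => exact HasPath.refl _
  | succ k ih =>
    refine HasPath.cons ((h.adj _ _).2 (Or.inl ⟨i, by omega, rfl, rfl⟩)) ?_
    rw [show i + (k + 1) = i + 1 + k by omega] at hj ⊢
    exact ih hj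

theorem hasPath_right (h : IsTwoIntervals G a b α β) {i j : ℕ} (hij : i ≤ j) (hj : j ≤ b) :
    HasPath G (j - i) (β i) (β j) := by
  obtain ⟨k, rfl⟩ := Nat.exists_eq_add_of_le hij
  rw [Nat.add_sub_cancel_left]
  clear hij
  induction k generalizing i with
  | zero => exact HasPath.refl _
  | succ k ih =>
    refine HasPath.cons ((h.adj _ _).2 (Or.inr ⟨i, by omega, rfl, rfl⟩)) ?_
    rw [show i + (k + 1) = i + 1 + k by omega] at hj ⊢
    exact ih hj

/-- The pair of common ends is excluded because the other interval may be a shortcut there. -/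
theorem le_dist_left (h : IsTwoIntervals G a b α β) {i j : ℕ} (hij : i ≤ j) (hj : j ≤ a)
    (hne : ¬ (i = 0 ∧ j = a)) : ((j - i : ℕ) : ℕ∞) ≤ dist G (α i) (α j) := by
  refine le_dist_of_forall fun k hk => ?_
  rcases h.eq_of_hasPath hk with ⟨s, hs, h1, h2⟩ | ⟨s, hs, h1, h2⟩
  · have := h.inj_left (by omega) (by omega) h1
    have := h.inj_left (by omega) (by omega) h2
    omega
  · have := h.ends (by omega) (by omega) h1
    have := h.ends (by omega) (by omega) h2
    omega

theorem le_dist_right (h : IsTwoIntervals G a b α β) (hba : b ≤ a) {i j : ℕ} (hij : i ≤ j)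
    (hj : j ≤ b) : ((j - i : ℕ) : ℕ∞) ≤ dist G (β i) (β j) := by
  refine le_dist_of_forall fun k hk => ?_
  rcases h.eq_of_hasPath hk with ⟨s, hs, h1, h2⟩ | ⟨s, hs, h1, h2⟩
  · have := h.ends (by omega) (by omega) h1.symm
    have := h.ends (by omega) (by omega) h2.symm
    omega
  · have := h.inj_right (by omega) (by omega) h1
    have := h.inj_right (by omega) (by omega) h2
    omega

theorem left_mem_interior (h : IsTwoIntervals G a b α β) {i : ℕ} (hi : i ≤ a) :
    α i ∈ arcInterior a α ↔ 0 < i ∧ i < a := by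
  constructor
  · rintro ⟨j, hj0, hja, hj⟩
    obtain rfl := h.inj_left hi hja.le hj
    exact ⟨hj0, hja⟩
  · rintro ⟨h1, h2⟩
    exact ⟨i, h1, h2, rfl⟩

theorem right_notMem_interior (h : IsTwoIntervals G a b α β) {j : ℕ} (hj : j ≤ b) :
    β j ∉ arcInterior a α := by
  rintro ⟨i, hi0, hia, hi⟩
  have := h.ends hia.le hj hi.symm
  omega

theorem swap (h : IsTwoIntervals G a b α β) : IsTwoIntervals G b a β α where
  start := h.start.symm
  finish := h.finish.symm
  cover x := (h.cover x).symm
  inj_left := h.inj_right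
  inj_right := h.inj_left
  ends hi hj e := (h.ends hj hi e.symm).imp And.symm And.symm
  adj x y := (h.adj x y).trans or_comm

theorem pathTo_right (h : IsTwoIntervals G a b α β) {j : ℕ} (hj : j ≤ b) :
    pathTo R a b α β (β j) = arc R β 0 j := by
  have hex : ∃ j' ≤ b, β j = β j' := ⟨j, hj, rfl⟩
  rw [pathTo, dif_pos hex]
  rw [← h.inj_right hj hex.choose_spec.1 hex.choose_spec.2]

theorem pathTo_left (h : IsTwoIntervals G a b α β) {i : ℕ} (hi : i < a) :
    pathTo R a b α β (α i) = arc R α 0 i := by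
  by_cases h0 : i = 0
  · subst h0
    rw [h.start, h.pathTo_right R (Nat.zero_le b)]
    simp [arc]
  · have hex : ∃ i' ≤ a, α i = α i' := ⟨i, hi.le, rfl⟩
    have hnex : ¬ ∃ j ≤ b, α i = β j := by
      rintro ⟨j, hj, e⟩
      have := h.ends hi.le hj e
      omega
    rw [pathTo, dif_neg hnex, dif_pos hex, ← h.inj_left hi.le hex.choose_spec.1 hex.choose_spec.2]

theorem pathBetween_right (h : IsTwoIntervals G a b α β) (γ : V × V →₀ R) {i j : ℕ} (hij : i ≤ j)
    (hj : j ≤ b) :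
    pathBetween R (β b) (arcInterior a α) (pathTo R a b α β) γ (β i) (β j) = arc R β i j := by
  have hi := h.right_notMem_interior (hij.trans hj)
  simp [pathBetween, hi, h.pathTo_right R hj, h.pathTo_right R (hij.trans hj),
    arc_sub_arc R β hij]

theorem pathBetween_left (h : IsTwoIntervals G a b α β) {i j : ℕ} (hij : i < j) (hj : j ≤ a)
    (hne : ¬ (i = 0 ∧ j = a)) :
    pathBetween R (β b) (arcInterior a α) (pathTo R a b α β) (arc R α 0 a - arc R β 0 b)
      (α i) (α j) = arc R α i j := by
  unfold pathBetween
  rw [h.pathTo_left R (hij.trans_le hj), h.left_mem_interior (hij.trans_le hj).le,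
    ← arc_sub_arc R α hij.le]
  rcases hj.eq_or_lt with rfl | hja
  -- At the finish `pathTo` follows `β`; adding `γ` trades `β` for `α`, which is the only way to
  -- continue from an interior vertex.
  · rw [h.finish, if_pos ⟨⟨by omega, hij⟩, rfl⟩, h.pathTo_right R le_rfl]
    abel
  · have hne' : α j ≠ β b := fun e => by
      have := h.ends hj le_rfl e
      omega
    rw [if_neg fun e => hne' e.2, h.pathTo_left R hja, add_zero]

/-- Only the first edge of `α` enters the interior, and it does so because the interior is nonempty
when `2 ≤ a`. -/
theorem linearCombination_entering_loop (h : IsTwoIntervals G a b α β) (ha : 2 ≤ a) :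
    Finsupp.linearCombination R (fun e : V × V => entering R (arcInterior a α) e.1 e.2)
      (arc R α 0 a - arc R β 0 b) = 1 := by
  have h1 : ∀ t ∈ Finset.Ico 0 a, entering R (arcInterior a α) (α t) (α (t + 1)) =
      if t = 0 then 1 else 0 := by
    intro t ht
    rw [Finset.mem_Ico] at ht
    have h3 := h.left_mem_interior ht.2.le
    have h4 := h.left_mem_interior ht.2
    unfold entering
    by_cases ht0 : t = 0
    · rw [if_pos ht0, if_pos ⟨fun hc => by have := h3.1 hc; omega, h4.2 (by omega)⟩]
    · rw [if_neg ht0, if_neg fun hc => hc.1 (h3.2 (by omega))]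
  have h2 : ∀ t ∈ Finset.Ico 0 b, entering R (arcInterior a α) (β t) (β (t + 1)) = 0 := by
    intro t ht
    rw [Finset.mem_Ico] at ht
    exact if_neg fun hc => h.right_notMem_interior ht.2 hc.2
  rw [map_sub, arc, arc, map_sum, map_sum]
  simp only [Finsupp.linearCombination_single, one_smul]
  rw [Finset.sum_congr rfl h1, Finset.sum_congr rfl h2]
  simp [show 0 < a by omega]

theorem isCycleModel (h : IsTwoIntervals G a b α β) (hba : b ≤ a) :
    IsCycleModel R G (β b) (arcInterior a α) (pathTo R a b α β) (arc R α 0 a - arc R β 0 b) a where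
  notMem := h.right_notMem_interior le_rfl
  reach x := by
    rcases h.cover x with ⟨i, hi, rfl⟩ | ⟨j, hj, rfl⟩
    · exact ⟨_, h.finish ▸ h.hasPath_left hi le_rfl⟩
    · exact ⟨_, h.hasPath_right hj le_rfl⟩
  eq_of_reach := by
    rintro x ⟨k, hk⟩
    rcases h.eq_of_hasPath hk with ⟨i, hi, h1, rfl⟩ | ⟨i, hi, h1, rfl⟩
    · have := h.inj_left le_rfl (by omega) (h.finish.trans h1)
      rw [← h.finish]
      congr 1
      omega
    · have := h.inj_right le_rfl (by omega) h1
      congr 1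
      omega
  mem_or_eq := by
    rintro x y ⟨k, hk⟩ hx
    rcases h.eq_of_hasPath hk with ⟨i, hi, rfl, rfl⟩ | ⟨i, hi, rfl, rfl⟩
    · rw [h.left_mem_interior (by omega)] at hx
      rw [h.left_mem_interior hi]
      by_cases hia : i + k = a
      · exact Or.inr (by rw [hia, h.finish])
      · exact Or.inl (by omega)
    · exact absurd hx (h.right_notMem_interior (by omega))
  edgeBoundary_path := by
    refine ⟨β 0, fun x => ?_⟩
    have right : ∀ j ≤ b, edgeBoundary R (pathTo R a b α β (β j)) =
        Finsupp.single (β j) 1 - Finsupp.single (β 0) 1 := fun j hj => by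
      rw [h.pathTo_right R hj, edgeBoundary_arc R β (Nat.zero_le j)]
    rcases h.cover x with ⟨i, hi, rfl⟩ | ⟨j, hj, rfl⟩
    · rcases hi.eq_or_lt with rfl | hi
      · rw [h.finish]
        exact right b le_rfl
      · rw [h.pathTo_left R hi, edgeBoundary_arc R α (Nat.zero_le i), h.start]
    · exact right j hj
  edgeBoundary_loop := by
    rw [map_sub, edgeBoundary_arc R α (Nat.zero_le a), edgeBoundary_arc R β (Nat.zero_le b),
      h.start, h.finish, sub_self]
  pathBetween_mem := by
    have right : ∀ i j, i ≤ j → j ≤ b → pathBetween R (β b) (arcInterior a α) (pathTo R a b α β)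
        (arc R α 0 a - arc R β 0 b) (β i) (β j) ∈ Finsupp.supported R R
          {e | Reach G e.1 e.2 ∧ Reach G e.2 (β j) ∧ dist G e.1 e.2 ≤ 1 ∧
            dist G e.1 e.2 + dist G e.2 (β j) ≤ dist G (β i) (β j)} := by
      intro i j hij hj
      rw [h.pathBetween_right R _ hij hj]
      refine arc_mem_supported R fun t hit htj => ?_
      have h1 := h.hasPath_right (Nat.le_succ t) (by omega)
      have h2 := h.hasPath_right (show t + 1 ≤ j from htj) hj
      have h3 := h1.dist_le
      rw [show t.succ - t = 1 by omega, Nat.cast_one] at h3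
      refine ⟨⟨_, h1⟩, ⟨_, h2⟩, h3, (add_le_add h3 h2.dist_le).trans
        (le_trans ?_ (h.le_dist_right hba hij hj))⟩
      exact_mod_cast (by omega : 1 + (j - (t + 1)) ≤ j - i)
    rintro x y ⟨k, hk⟩
    rcases h.eq_of_hasPath hk with ⟨i, hi, rfl, rfl⟩ | ⟨i, hi, rfl, rfl⟩
    -- Between the common ends the chosen path is `β`, a geodesic because `b ≤ a`, even if the given
    -- path runs along `α`.
    · by_cases h0a : i = 0 ∧ i + k = a
      · rw [h0a.2, h0a.1, h.start, h.finish]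
        exact right 0 b (Nat.zero_le b) le_rfl
      rcases Nat.eq_zero_or_pos k with rfl | hk0
      · have : ¬ (α i ∈ arcInterior a α ∧ α i = β b) := fun hc =>
          h.right_notMem_interior le_rfl (hc.2 ▸ hc.1)
        simp [pathBetween, this]
      rw [h.pathBetween_left R (by omega) hi h0a]
      refine arc_mem_supported R fun t hit htj => ?_
      have h1 := h.hasPath_left (Nat.le_succ t) (by omega)
      have h2 := h.hasPath_left (show t + 1 ≤ i + k from htj) hi
      have h3 := h1.dist_le
      rw [show t.succ - t = 1 by omega, Nat.cast_one] at h3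
      refine ⟨⟨_, h1⟩, ⟨_, h2⟩, h3, (add_le_add h3 h2.dist_le).trans
        (le_trans ?_ (h.le_dist_left (Nat.le_add_right i k) hi h0a))⟩
      exact_mod_cast (by omega : 1 + (i + k - (t + 1)) ≤ i + k - i)
    · exact right i (i + k) (Nat.le_add_right i k) hi
  loop_mem := by
    refine Submodule.sub_mem _ (arc_mem_supported R fun t _ ht => ?_)
      (arc_mem_supported R fun t _ ht => ?_)
    · have h1 := h.hasPath_left (Nat.le_succ t) (by omega)
      have h2 := h.hasPath_left (show t + 1 ≤ a from ht) le_rfl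
      rw [h.finish] at h2
      have h3 := h1.dist_le
      rw [show t.succ - t = 1 by omega, Nat.cast_one] at h3
      refine ⟨⟨_, h1⟩, h3, (add_le_add h3 h2.dist_le).trans ?_⟩
      exact_mod_cast (by omega : 1 + (a - (t + 1)) ≤ a)
    · have h1 := h.hasPath_right (Nat.le_succ t) (by omega)
      have h2 := h.hasPath_right (show t + 1 ≤ b from ht) le_rfl
      have h3 := h1.dist_le
      rw [show t.succ - t = 1 by omega, Nat.cast_one] at h3
      refine ⟨⟨_, h1⟩, h3, (add_le_add h3 h2.dist_le).trans ?_⟩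
      exact_mod_cast (by omega : 1 + (b - (t + 1)) ≤ a)
  loop_entering := by
    by_cases ha : 2 ≤ a
    · exact Or.inr (h.linearCombination_entering_loop R ha)
    · refine Or.inl (Set.eq_empty_of_forall_notMem ?_)
      rintro x ⟨i, h1, h2, -⟩
      omega
  le_dist := by
    rintro x y hx ⟨j, hj0, hja, rfl⟩ ⟨k, hk⟩
    -- A vertex outside the interior that reaches `α j` with `0 < j < a` must be the common start,
    -- and the two distances are then `j` and `a - j`.
    rcases h.eq_of_hasPath hk with ⟨i, hi, rfl, h2⟩ | ⟨i, hi, rfl, h2⟩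
    · obtain rfl := h.inj_left hja.le hi h2
      rw [h.left_mem_interior (by omega)] at hx
      rw [← h.finish]
      refine le_trans ?_ (add_le_add (h.le_dist_left (Nat.le_add_right i k) hi (by omega))
        (h.le_dist_left hja.le le_rfl (by omega)))
      exact_mod_cast (by omega : a ≤ i + k - i + (a - (i + k)))
    · have := h.ends hja.le hi h2
      obtain rfl : i = 0 := by omega
      omega

end IsTwoIntervals

end TwoIntervals

/-! ### Bi-directed cycles -/

/-- The minimum only keeps the values in range: for `t ≤ m` it equals `t`. The second interval
starts at 0 and then descends from `m + n - 1`; the case `t = 0` is separate because `m + n` stands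
for the vertex 0. -/
theorem isTwoIntervals_biCycle {m n : ℕ} (hm : 1 ≤ m) (hn : 1 ≤ n) :
    IsTwoIntervals (biCycle m n) m n (fun t => ⟨min t (m + n - 1), by omega⟩)
      (fun t => ⟨if t = 0 then 0 else m + n - t, by split_ifs <;> omega⟩) where
  start := by simp
  finish := by
    rw [Fin.mk.injEq, if_neg (by omega)]
    omega
  cover := by
    rintro ⟨x, hx⟩
    by_cases hxm : x ≤ m
    · exact Or.inl ⟨x, hxm, by rw [Fin.mk.injEq]; omega⟩
    · exact Or.inr ⟨m + n - x, by omega, by rw [Fin.mk.injEq, if_neg (by omega)]; omega⟩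
  inj_left hi hj e := by
    rw [Fin.mk.injEq] at e
    omega
  inj_right hi hj e := by
    rw [Fin.mk.injEq] at e
    split_ifs at e <;> omega
  ends hi hj e := by
    rw [Fin.mk.injEq] at e
    split_ifs at e <;> omega
  adj := by
    rintro ⟨x, hx⟩ ⟨y, hy⟩
    -- Splitting off the wrap-around `y = m + n - 1`, which gives the edge out of 0, replaces the
    -- remainder by a linear condition.
    obtain ⟨z, hmod, hz⟩ : ∃ z, (y + 1) % (m + n) = z ∧
        (y + 1 = m + n ∧ z = 0 ∨ y + 1 ≠ m + n ∧ z = y + 1) := by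
      by_cases h : y + 1 = m + n
      · exact ⟨0, by rw [h, Nat.mod_self], Or.inl ⟨h, rfl⟩⟩
      · exact ⟨y + 1, Nat.mod_eq_of_lt (by omega), Or.inr ⟨h, rfl⟩⟩
    simp only [biCycle, Fin.mk.injEq, hmod, Nat.add_eq_zero_iff, one_ne_zero, and_false, if_false]
    refine or_congr ⟨fun h => ⟨x, by omega⟩, ?_⟩ ⟨fun h => ⟨m + n - (y + 1), ?_⟩, ?_⟩
    · rintro ⟨t, ht⟩
      omega
    · split_ifs at h ⊢ <;> omega
    · rintro ⟨t, ht, h1, h2⟩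
      split_ifs at h1 h2 ⊢ <;> omega

theorem exists_isCycleModel_biCycle (R : Type u) [CommRing R] {m n : ℕ} (hm : 1 ≤ m)
    (hn : 1 ≤ n) : ∃ w I Φ γ, IsCycleModel R (biCycle m n) w I Φ γ (max m n) ∧
      (2 ≤ max m n → I.Nonempty) := by
  have nonempty : ∀ {a : ℕ} {α : ℕ → Fin (m + n)}, 2 ≤ a → (arcInterior a α).Nonempty :=
    fun {a α} ha => ⟨α 1, 1, one_pos, ha, rfl⟩
  have h := isTwoIntervals_biCycle hm hn
  rcases le_total n m with hnm | hmn
  · rw [max_eq_left hnm]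
    exact ⟨_, _, _, _, h.isCycleModel R hnm, nonempty⟩
  · rw [max_eq_right hmn]
    exact ⟨_, _, _, _, h.swap.isCycleModel R hmn, nonempty⟩

end MPSS

theorem mainTheorem5 (R : Type*) [CommRing R] (m n M : ℕ) (hm : 1 ≤ m) (hn : 1 ≤ n)
    (hM : M = max m n) :
    (3 ≤ M →
      -- bigraded path homology, in the bidegrees of the spectral sequence
      (∀ i j : ℤ, (i, j) ∈ ({(0, 0), (1, 0), ((M : ℤ), -((M : ℤ) - 2))} : Set (ℤ × ℤ)) →
        Nonempty (MPSS.PH R (MPSS.biCycle m n) (i + j) i ≃ₗ[R] R)) ∧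
      (∀ i j : ℤ, (i, j) ∉ ({(0, 0), (1, 0), ((M : ℤ), -((M : ℤ) - 2))} : Set (ℤ × ℤ)) →
        Subsingleton (MPSS.PH R (MPSS.biCycle m n) (i + j) i)) ∧
      -- the differentials of the pages `2, …, M - 2` vanish
      (∀ r : ℕ, 2 ≤ r → r + 1 ≤ M - 1 → ∀ p q : ℤ,
        (MPSS.filteredRC R (MPSS.biCycle m n)).diff r p (p + q) = 0) ∧
      -- the pages `2, …, M - 1` agree, classes being identified through common representatives
      (∀ r s : ℕ, 2 ≤ r → ∀ hrs : r ≤ s, s ≤ M - 1 → ∀ i j : ℤ,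
        ∃ e : MPSS.E R (MPSS.biCycle m n) s i j ≃ₗ[R] MPSS.E R (MPSS.biCycle m n) r i j,
          ∀ x : (MPSS.filteredRC R (MPSS.biCycle m n)).A s i (i + j),
            e ((MPSS.filteredRC R (MPSS.biCycle m n)).cls s i (i + j) x) =
              (MPSS.filteredRC R (MPSS.biCycle m n)).cls r i (i + j)
                (Submodule.inclusion ((MPSS.filteredRC R (MPSS.biCycle m n)).A_anti
                  (Int.ofNat_le.2 hrs) i (i + j)) x)) ∧
      -- page `M` is trivial
      Nonempty (MPSS.E R (MPSS.biCycle m n) M 0 0 ≃ₗ[R] R) ∧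
      (∀ i j : ℤ, (i, j) ≠ (0, 0) → Subsingleton (MPSS.E R (MPSS.biCycle m n) M i j))) ∧
    (M ≤ 2 →
      Nonempty (MPSS.PH R (MPSS.biCycle m n) 0 0 ≃ₗ[R] R) ∧
      (∀ i j : ℤ, (i, j) ≠ (0, 0) →
        Subsingleton (MPSS.PH R (MPSS.biCycle m n) (i + j) i))) := by
  obtain ⟨w, I, Φ, γ, h, hI⟩ := MPSS.exists_isCycleModel_biCycle R hm hn
  rw [← hM] at h hI
  have zero : ∀ r : ℕ, 2 ≤ r → ∀ k : ℤ, k = 0 →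
      Nonempty ((MPSS.filteredRC R (MPSS.biCycle m n)).page r 0 k ≃ₗ[R] R) := by
    rintro r hr _ rfl
    obtain ⟨e, -⟩ := h.page_zero_equiv hr
    exact ⟨e⟩
  refine ⟨fun hM3 => ⟨?_, ?_, ?_, ?_, ?_, ?_⟩, fun hM2 => ⟨?_, ?_⟩⟩
  · intro i j hij
    have hI' := hI (by omega)
    simp only [Set.mem_insert_iff, Set.mem_singleton_iff, Prod.mk.injEq] at hij
    rcases hij with ⟨rfl, rfl⟩ | ⟨rfl, rfl⟩ | ⟨rfl, rfl⟩
    · exact zero 2 le_rfl _ (by ring)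
    · obtain ⟨e, -⟩ := h.page_loop_equiv hI' le_rfl hM3
      exact ⟨e⟩
    · obtain ⟨e, -⟩ := h.page_cone_equiv hI' le_rfl hM3
      -- The total degree in the goal equals 2 only after a computation, and the type of the page
      -- depends on it, so the degree is generalised first.
      have key : ∀ k : ℤ, k = 2 →
          Nonempty ((MPSS.filteredRC R (MPSS.biCycle m n)).page 2 M k ≃ₗ[R] R) := by
        rintro _ rfl
        exact ⟨e⟩
      exact key _ (by ring)
  · intro i j hij
    simp only [Set.mem_insert_iff, Set.mem_singleton_iff, Prod.mk.injEq, not_or] at hij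
    exact h.subsingleton_page le_rfl (by omega) (by omega)
  · exact fun r hr hrM p q => h.diff_eq_zero hr (by omega) p (p + q)
  · exact fun r s hr hrs hs i j =>
      h.exists_page_equiv_page (hI (by omega)) hr hrs (by omega) i (i + j)
  · exact zero M (by omega) _ (by ring)
  · intro i j hij
    rw [ne_eq, Prod.mk.injEq] at hij
    exact h.subsingleton_page (by omega) (by omega) (Or.inl le_rfl)
  · exact zero 2 le_rfl _ (by ring)
  · intro i j hij
    rw [ne_eq, Prod.mk.injEq] at hij
    -- For `M ≤ 2` the loop and its cone have already cancelled by page 2.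
    exact h.subsingleton_page le_rfl (by omega) (Or.inl hM2)
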